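/- Fix a field $\mathbb{F}$. For a finite metric space $(X,d_X)$, the Rips filtration assigns to $\sigma\subseteq X$ its diameter $F^{\mathrm R}_X(\sigma)=\max_{x,x'\in\sigma}d_X(x,x')$ (and $0$ to $\sigma=\emptyset$). For $\varepsilon\in\mathbb{R}$ let $L_\varepsilon(X)$ be the simplicial complex of all nonempty $\sigma\subseteq X$ with $F^{\mathrm R}_X(\sigma)\le\varepsilon$. For $k\in\mathbb{N}=\{0,1,2,\dots\}$ let $\mathbb{V}_k(X)$ be the persistence vector space formed by the (unreduced) simplicial homology spaces $H_k(L_\varepsilon(X);\mathbb{F})$, $\varepsilon\in\mathbb{R}$, and the maps induced by the inclusions $L_\varepsilon(X)\subseteq L_{\varepsilon'}(X)$, $\varepsilon\le\varepsilon'$. The persistence diagram $\mathrm{D}_k(F^{\mathrm R}_X)$ is the finite multiset of points $(b,d)$ with $b\in\mathbb{R}$, $d\in\mathbb{R}\cup\{+\infty\}$, $b<d$, such that $\mathbb{V}_k(X)$ is isomorphic to the direct sum, with multiplicity, of the interval modules of the intervals $[b,d)$. For two finite multisets $D_1=\{P_\alpha\}_{\alpha\in A_1}$ and $D_2=\{Q_\alpha\}_{\alpha\in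 A_2}$ of such points, the bottleneck distance $d_{\mathcal D}(D_1,D_2)$ is the minimum, over all $B_1\subseteq A_1$, $B_2\subseteq A_2$ and bijections $\varphi:B_1\to B_2$, of $$J(\varphi)=\max\Big(\max_{\beta\in B_1}\|P_\beta-Q_{\varphi(\beta)}\|_\infty,\ \max_{\alpha\in A_1\setminus B_1}\tfrac12\,\mathrm{pers}(P_\alpha),\ \max_{\alpha\in A_2\setminus B_2}\tfrac12\,\mathrm{pers}(Q_\alpha)\Big)\in[0,\infty],$$ where $\mathrm{pers}(b,d)=d-b$, a maximum over the empty set is $0$, two infinite deaths are at distance $0$, and a finite and an infinite death are at distance $\infty$. The Gromov–Hausdorff distance is $$d_{\mathrm{GH}}(X,Y)=\tfrac12\inf_R\ \sup_{(x,y),(x',y')\in R}\big|d_X(x,x')-d_Y(y,y')\big|\in[0,\infty],$$ where $R$ ranges over all correspondences, i.e. subsets of $X\times Y$ that project onto $X$ and onto $Y$ (with $\inf\emptyset=\infty$ and $\sup\emptyset=0$). Theorem. For all finite metric spaces $X$ and $Y$ and every $k\in\mathbb{N}$, the persistence diagrams $\mathrm{D}_k(F^{\mathrm R}_X)$ and $\mathrm{D}_k(F^{\mathrm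 R}_Y)$ exist and are unique, and $$d_{\mathcal D}\big(\mathrm{D}_k(F^{\mathrm R}_X),\mathrm{D}_k(F^{\mathrm R}_Y)\big)\le 2\,d_{\mathrm{GH}}(X,Y).$$ -/

import Mathlib

open scoped ENNReal

noncomputable section

namespace PersistentHomology

universe u v w

/-! ### Simplicial homology with coefficients in a field -/

section Homology

variable (F : Type u) [Field F] {X : Type v}

/-- The ambient space of all oriented chains on the vertex set `X`: the exterior algebra of the
vector space with basis `X`. -/
abbrev Chain (F : Type u) [Field F] (X : Type v) : Type (max u v) := ExteriorAlgebra F (X →₀ F)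

/-- The oriented simplex `[v₀, …, vₙ₋₁]`, represented by `v₀ ∧ ⋯ ∧ vₙ₋₁`. It changes sign by the
signature when the vertices are permuted and is zero when a vertex is repeated, and these are the
only linear relations between oriented simplices. -/
def oriented {n : ℕ} (x : Fin n → X) : Chain F X :=
  ExteriorAlgebra.ιMulti F n (fun i => Finsupp.single (x i) (1 : F))

/-- The boundary operator, i.e. the antiderivation of the exterior algebra that sends every vertex
to `1`. See `boundary_oriented` for the usual formula. -/
def boundary : Chain F X →ₗ[F] Chain F X :=
  CliffordAlgebra.contractLeft (Q := (0 : QuadraticForm F (X →₀ F)))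
    (Finsupp.linearCombination F (fun _ : X => (1 : F)))

/-- `∂[v₀, …, vₙ] = ∑ᵢ (-1)ⁱ [v₀, …, v̂ᵢ, …, vₙ]`. -/
theorem boundary_oriented {n : ℕ} (x : Fin (n + 1) → X) :
    boundary F (oriented F x) =
      ∑ i : Fin (n + 1), (-1 : F) ^ (i : ℕ) • oriented F (fun j => x (i.succAbove j)) := by
  induction n with
  | zero =>
    simp only [oriented, boundary, ExteriorAlgebra.ιMulti_succ_apply]
    erw [CliffordAlgebra.contractLeft_ι_mul]
    simp
  | succ n ih =>
    have h : oriented F x = ExteriorAlgebra.ι F (Finsupp.single (x 0) (1 : F)) *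
        oriented F (fun j => x (Fin.succ j)) := by
      simp only [oriented, ExteriorAlgebra.ιMulti_succ_apply]
      rfl
    have h2 : boundary F (oriented F x) = oriented F (fun j => x (Fin.succ j)) -
        ExteriorAlgebra.ι F (Finsupp.single (x 0) (1 : F)) *
          boundary F (oriented F (fun j => x (Fin.succ j))) := by
      rw [h]
      refine (CliffordAlgebra.contractLeft_ι_mul _ _ _).trans ?_
      simp
      rfl
    rw [h2, ih, Finset.mul_sum, sub_eq_add_neg, ← Finset.sum_neg_distrib,
      Fin.sum_univ_succ (n := n + 1)]
    congr 1
    · simp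
    · refine Finset.sum_congr rfl fun i _ => ?_
      have h3 : oriented F (fun j => x (i.succ.succAbove j)) =
          ExteriorAlgebra.ι F (Finsupp.single (x 0) (1 : F)) *
            oriented F (fun j => x (Fin.succ (i.succAbove j))) := by
        simp only [oriented, ExteriorAlgebra.ιMulti_succ_apply (n := n)]
        simp [Matrix.vecTail, Function.comp_def]
      rw [h3]
      simp [pow_succ]

variable (K : PreAbstractSimplicialComplex X)

/-- The space `C_k(K)` of simplicial `k`-chains of `K`: the span of the oriented simplices
`[v₀, …, v_k]` whose vertex set is a face of `K`. -/
def chains (k : ℕ) : Submodule F (Chain F X) :=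
  Submodule.span F {c | ∃ x : Fin (k + 1) → X,
    (∃ σ ∈ K, (σ : Set X) = Set.range x) ∧ c = oriented F x}

/-- The `k`-cycles of `K`: the kernel of `∂ : C_k(K) → C_{k-1}(K)`, where `C_{-1} = 0`
(homology is not reduced). -/
def cycles : ℕ → Submodule F (Chain F X)
  | 0 => chains F K 0
  | k + 1 => chains F K (k + 1) ⊓ LinearMap.ker (boundary F)

/-- The `k`-boundaries of `K`: the image of `∂ : C_{k+1}(K) → C_k(K)`. -/
def boundaries (k : ℕ) : Submodule F (Chain F X) :=
  (chains F K (k + 1)).map (boundary F)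

theorem boundaries_le_cycles (k : ℕ) : boundaries F K k ≤ cycles F K k := by
  have h1 : boundaries F K k ≤ chains F K k := by
    rw [boundaries, Submodule.map_le_iff_le_comap, chains, Submodule.span_le]
    rintro c ⟨x, ⟨σ, hσ, hx⟩, rfl⟩
    simp only [Submodule.comap_coe, Set.mem_preimage, SetLike.mem_coe, boundary_oriented]
    refine Submodule.sum_mem _ fun i _ => Submodule.smul_mem _ _ (Submodule.subset_span ?_)
    classical
    refine ⟨_, ⟨Finset.univ.image fun j => x (i.succAbove j), ?_, by simp⟩, rfl⟩
    refine (K.isRelLowerSet_faces hσ).2 ?_ (by simp)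
    rw [← Finset.coe_subset, hx]
    rintro _ h
    obtain ⟨j, -, rfl⟩ := Finset.mem_image.1 (Finset.mem_coe.1 h)
    exact ⟨_, rfl⟩
  cases k with
  | zero => exact h1
  | succ k =>
    refine le_inf h1 ?_
    rw [boundaries, Submodule.map_le_iff_le_comap]
    intro c _
    exact CliffordAlgebra.contractLeft_contractLeft
      (Q := (0 : QuadraticForm F (X →₀ F))) _ _

/-- The simplicial homology `H_k(K; F)`. -/
abbrev Homology (k : ℕ) : Type (max u v) :=
  cycles F K k ⧸ (boundaries F K k).submoduleOf (cycles F K k)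

variable {K} {L M : PreAbstractSimplicialComplex X}

theorem chains_mono (h : K ≤ L) (k : ℕ) : chains F K k ≤ chains F L k := by
  refine Submodule.span_mono ?_
  rintro c ⟨x, ⟨σ, hσ, hx⟩, rfl⟩
  exact ⟨x, ⟨σ, h hσ, hx⟩, rfl⟩

theorem cycles_mono (h : K ≤ L) (k : ℕ) : cycles F K k ≤ cycles F L k := by
  cases k with
  | zero => exact chains_mono F h 0
  | succ k => exact inf_le_inf_right _ (chains_mono F h _)

theorem boundaries_mono (h : K ≤ L) (k : ℕ) : boundaries F K k ≤ boundaries F L k :=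
  Submodule.map_mono (chains_mono F h _)

/-- The map `H_k(K) → H_k(L)` induced by an inclusion `K ⊆ L`. -/
def homologyMap (h : K ≤ L) (k : ℕ) : Homology F K k →ₗ[F] Homology F L k :=
  Submodule.mapQ _ _ (Submodule.inclusion (cycles_mono F h k))
    (fun _ hc => boundaries_mono F h k hc)

theorem homologyMap_refl (k : ℕ) : homologyMap F (le_refl K) k = LinearMap.id := by
  refine LinearMap.ext fun c => ?_
  obtain ⟨c, rfl⟩ := Submodule.Quotient.mk_surjective _ c
  rfl

theorem homologyMap_comp (h : K ≤ L) (h' : L ≤ M) (k : ℕ) :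
    homologyMap F h' k ∘ₗ homologyMap F h k = homologyMap F (h.trans h') k := by
  refine LinearMap.ext fun c => ?_
  obtain ⟨c, rfl⟩ := Submodule.Quotient.mk_surjective _ c
  rfl

end Homology

/-! ### Persistence vector spaces and their diagrams -/

/-- A persistence vector space `{V_s → V_t}_{s ≤ t}` over `F`, indexed by the real line. -/
structure PersistenceModule (F : Type u) [Field F] where
  /-- the vector space at parameter `t` -/
  V : ℝ → Type w
  [addCommGroup : ∀ t, AddCommGroup (V t)]
  [module : ∀ t, Module F (V t)]
  /-- the structure maps -/
  map : ∀ {s t : ℝ}, s ≤ t → V s →ₗ[F] V t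
  map_refl : ∀ t : ℝ, map (le_refl t) = LinearMap.id
  map_comp : ∀ {r s t : ℝ} (h : r ≤ s) (h' : s ≤ t), map h' ∘ₗ map h = map (h.trans h')

attribute [instance] PersistenceModule.addCommGroup PersistenceModule.module

/-- A point `(b, d)` of a persistence diagram, with finite birth `b` and a death `d` that may be
`+∞`; it stands for the interval `[b, d)`. -/
abbrev DgmPoint : Type := ℝ × EReal

/-- The parameter `t` belongs to the interval `[b, d)`. -/
def DgmPoint.Alive (p : DgmPoint) (t : ℝ) : Prop := p.1 ≤ t ∧ (t : EReal) < p.2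

/-- The value of the interval module of `[b, d)` at `t`: the field `F` if `t` belongs to the interval
and `0` otherwise. -/
def intervalSpace (F : Type u) [Field F] (p : DgmPoint) (t : ℝ) : Submodule F F where
  carrier := {x | ¬ p.Alive t → x = 0}
  zero_mem' := fun _ => rfl
  add_mem' := fun hx hy h => by rw [hx h, hy h, add_zero]
  smul_mem' := fun c x hx h => by rw [hx h, smul_zero]

open Classical in
/-- The interval module of `[b, d)`: the map between two parameters in the interval is the identity
of `F`, and every other structure map is zero. -/
def intervalModule (F : Type u) [Field F] (p : DgmPoint) : PersistenceModule.{u, u} F where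
  V t := intervalSpace F p t
  map {s t} _ :=
    { toFun := fun x => ⟨if p.Alive t then (x : F) else 0, fun h => if_neg h⟩
      map_add' := fun x y => by ext; by_cases h : p.Alive t <;> simp [h]
      map_smul' := fun c x => by ext; by_cases h : p.Alive t <;> simp [h] }
  map_refl t := by
    ext x
    by_cases h : p.Alive t
    · simp [h]
    · simp [h, x.2 h]
  map_comp {r s t} h h' := by
    ext x
    by_cases ht : p.Alive t
    · by_cases hs : p.Alive s
      · simp [ht, hs]
      · have hr : ¬ p.Alive r := fun hr =>
          hs ⟨hr.1.trans h, lt_of_le_of_lt (EReal.coe_le_coe_iff.2 h') ht.2⟩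
        simp [hs, x.2 hr]
    · simp [ht]

/-- The direct sum of a finite family of persistence vector spaces. -/
def PersistenceModule.directSum {F : Type u} [Field F] {ι : Type v} [Finite ι]
    (W : ι → PersistenceModule.{u, w} F) : PersistenceModule.{u, max v w} F where
  V t := ∀ i, (W i).V t
  map h := LinearMap.pi fun i => (W i).map h ∘ₗ LinearMap.proj i
  map_refl t := by
    ext x i
    simp [(W i).map_refl]
  map_comp h h' := by
    refine LinearMap.ext fun x => funext fun i => ?_
    exact LinearMap.congr_fun ((W i).map_comp h h') (x i)

/-- Two persistence vector spaces are isomorphic: there are linear isomorphisms at all parameters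
that commute with the structure maps. -/
def PersistenceModule.IsIsomorphic {F : Type u} [Field F]
    (V : PersistenceModule.{u, v} F) (W : PersistenceModule.{u, w} F) : Prop :=
  ∃ e : ∀ t, V.V t ≃ₗ[F] W.V t,
    ∀ (s t : ℝ) (h : s ≤ t) (x : V.V s), e t (V.map h x) = W.map h (e s x)

open Classical in
/-- `D` is the multiset of intervals of `V`: all intervals of `D` are nonempty, and `V` is isomorphic
to the direct sum of their interval modules, taken with multiplicity. -/
def IsDiagram {F : Type u} [Field F] (V : PersistenceModule.{u, v} F)
    (D : Multiset DgmPoint) : Prop :=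
  (∀ p ∈ D, (p.1 : EReal) < p.2) ∧
    V.IsIsomorphic (PersistenceModule.directSum fun i : D.ToType => intervalModule F i.1)

open Classical in
/-- The persistence diagram `I(V)` of a persistence vector space. It is meaningful when `V` has
exactly one multiset of intervals; if there is none, the value is the empty multiset. -/
def diagram {F : Type u} [Field F] (V : PersistenceModule.{u, v} F) : Multiset DgmPoint :=
  if h : ∃ D, IsDiagram V D then h.choose else 0

/-! ### Filtrations -/

/-- A filtration on `X`: a monotone real-valued function on the finite subsets of `X`. -/
abbrev Filtration (X : Type v) : Type v := Finset X →o ℝ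

/-- The sublevel complex `L_ε = {σ ⊆ X | f(σ) ≤ ε}` (its faces are nonempty). -/
def Filtration.sublevel {X : Type v} (f : Filtration X) (ε : ℝ) :
    PreAbstractSimplicialComplex X where
  faces := {σ | σ.Nonempty ∧ f σ ≤ ε}
  isRelLowerSet_faces := fun _ h => ⟨h.1, fun _ hτ hne => ⟨hne, (f.monotone hτ).trans h.2⟩⟩

theorem Filtration.sublevel_mono {X : Type v} (f : Filtration X) {s t : ℝ} (h : s ≤ t) :
    f.sublevel s ≤ f.sublevel t :=
  fun _ hσ => ⟨hσ.1, hσ.2.trans h⟩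

/-- The persistence vector space `{H_k(L_s) → H_k(L_t)}_{s ≤ t}` of a filtration. -/
def Filtration.persistentHomology (F : Type u) [Field F] {X : Type v} (f : Filtration X) (k : ℕ) :
    PersistenceModule.{u, max u v} F where
  V t := Homology F (f.sublevel t) k
  map h := homologyMap F (f.sublevel_mono h) k
  map_refl _ := homologyMap_refl F k
  map_comp h h' := homologyMap_comp F (f.sublevel_mono h) (f.sublevel_mono h') k

/-- The Rips filtration of a metric space: the value at a finite set is its diameter. -/
def rips (X : Type v) [MetricSpace X] : Filtration X where
  toFun σ := Metric.diam (σ : Set X)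
  monotone' := fun _ τ h => Metric.diam_mono (Finset.coe_subset.2 h) τ.finite_toSet.isBounded

/-! ### The bottleneck distance -/

/-- The distance of two deaths in `ℝ ∪ {+∞}`: `|d - d'|` when both are finite, `0` when both are
infinite, and `∞` when exactly one is infinite. -/
def deathDist (d d' : EReal) : ℝ≥0∞ :=
  if d = d' then 0 else (d - d').abs

/-- The `ℓ^∞` distance of two points of persistence diagrams. -/
def DgmPoint.supDist (p q : DgmPoint) : ℝ≥0∞ :=
  max (edist p.1 q.1) (deathDist p.2 q.2)

/-- The persistence `d - b` of a point `(b, d)`. -/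
def DgmPoint.pers (p : DgmPoint) : ℝ≥0∞ := (p.2 - (p.1 : EReal)).toENNReal

/-- The cost `J(φ)` of a partial bijection `φ : B₁ → B₂` between two families of points. -/
def matchingCost {A₁ A₂ : Type} (P : A₁ → DgmPoint) (Q : A₂ → DgmPoint)
    {B₁ : Set A₁} {B₂ : Set A₂} (φ : B₁ ≃ B₂) : ℝ≥0∞ :=
  max (⨆ β : B₁, (P β).supDist (Q (φ β)))
    (max (⨆ α : (B₁ᶜ : Set A₁), (P α).pers / 2) (⨆ α : (B₂ᶜ : Set A₂), (Q α).pers / 2))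

open Classical in
/-- The bottleneck distance of two finite persistence diagrams: the least cost of a bijection
between a subset of the points of the first and a subset of the points of the second, points
being counted with multiplicity. -/
def bottleneckDist (D₁ D₂ : Multiset DgmPoint) : ℝ≥0∞ :=
  ⨅ (B₁ : Set D₁.ToType) (B₂ : Set D₂.ToType) (φ : B₁ ≃ B₂),
    matchingCost (fun α : D₁.ToType => α.1) (fun α : D₂.ToType => α.1) φ

/-! ### The Gromov-Hausdorff distance -/

/-- A correspondence: a relation whose two projections are surjective. -/
def IsCorrespondence {X : Type v} {Y : Type w} (R : Set (X × Y)) : Prop :=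
  (∀ x, ∃ y, (x, y) ∈ R) ∧ ∀ y, ∃ x, (x, y) ∈ R

/-- The distortion of a relation between two metric spaces. -/
def distortion {X : Type v} {Y : Type w} [MetricSpace X] [MetricSpace Y] (R : Set (X × Y)) :
    ℝ≥0∞ :=
  ⨆ (p ∈ R) (q ∈ R), ENNReal.ofReal |dist p.1 q.1 - dist p.2 q.2|

/-- The Gromov-Hausdorff distance: half of the infimum of the distortions of correspondences. -/
def ghDist (X : Type v) (Y : Type w) [MetricSpace X] [MetricSpace Y] : ℝ≥0∞ :=
  (⨅ (R : Set (X × Y)) (_ : IsCorrespondence R), distortion R) / 2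

end PersistentHomology

namespace PersistentHomology

universe u v w

/-! ### Bases adapted to two chains of subspaces -/

section Adapted

variable {F : Type u} [Field F] {V : Type v} [AddCommGroup V] [Module F V]

/-! The stability is proved at chain level, without interleavings. The cycle spaces of the sublevel
complexes of a filtration form one chain of subspaces, and the boundary spaces form another. Two
chains of subspaces of a finite-dimensional space always have a common adapted basis
(`exists_adapted_set`). Each basis element is born when it becomes a cycle and dies when it becomes
a boundary. Reading off coordinates therefore splits persistent homology into interval modules
(`isIsomorphic_directSum`), and this gives existence of the diagram. Uniqueness holds because the
ranks of the structure maps determine the multiset of intervals (`eq_of_countP_eq`).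

The adapted basis depends only on the preorder that the filtration `f` induces on simplices. If `g`
is a coarsening of `f`, meaning that `f α ≤ f β` implies `g α ≤ g β`, the same basis with the same
birth and death simplices decomposes `g` too. Pairing points with the same index then gives a
matching of cost at most the sup distance of `f` and `g` (`diagramsWithin_of_coarser`). For
arbitrary `f` and `g` on the same vertices, move along the segment `(1 - t) f + t g`. Close to a
given `t` every filtration of the segment has the one at `t` as a coarsening, so the local estimates
add up along `[0, 1]` (`diagramsWithin_of_abs_sub_le`).

Finally, a correspondence `R` between `X` and `Y` is itself a finite vertex set that surjects onto
both. Pulling a filtration back along a surjection only duplicates vertices and does not change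
persistent homology (`isIsomorphic_comap`). The two Rips filtrations pulled back to `R` differ by at
most the distortion of `R`, and the infimum of the distortions is twice the Gromov–Hausdorff
distance. -/

theorem exists_adapted_set_of_le [FiniteDimensional F V] {𝒵 𝓑 : Set (Submodule F V)}
    (hZ : IsChain (· ≤ ·) 𝒵) (hB : IsChain (· ≤ ·) 𝓑) (W : Submodule F V) :
    ∃ s : Set V, LinearIndepOn F id s ∧ Submodule.span F s = W ∧
      ∀ U ∈ 𝒵 ∪ 𝓑, W ⊓ U ≤ Submodule.span F (s ∩ U) := by
  induction W using WellFoundedLT.induction with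
  | ind W ih =>
  rcases eq_or_ne W ⊥ with rfl | hW
  · exact ⟨∅, linearIndepOn_empty F id, by simp, fun U _ => by simp⟩
  -- A hyperplane of `W` containing every proper trace `W ⊓ U` with `U ∈ 𝒵`. Since `𝒵` is a chain,
  -- it suffices that it contains the largest one, which exists by finite dimension.
  have hW' : ∃ W', W' ⋖ W ∧ ∀ U ∈ 𝒵, ¬ W ≤ U → W ⊓ U ≤ W' := by
    by_cases h : ∃ U ∈ 𝒵, ¬ W ≤ U
    · obtain ⟨M, ⟨U₀, hU₀, hWU₀, rfl⟩, hM⟩ := wellFounded_gt.has_min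
        {M | ∃ U ∈ 𝒵, ¬ W ≤ U ∧ W ⊓ U = M} (by obtain ⟨U, h1, h2⟩ := h; exact ⟨_, U, h1, h2, rfl⟩)
      obtain ⟨W', h1, h2⟩ := exists_le_covBy_of_lt (inf_lt_left.2 hWU₀)
      refine ⟨W', h2, fun U hU hWU => le_trans ?_ h1⟩
      rcases hZ.total hU hU₀ with h3 | h3
      · exact inf_le_inf_left W h3
      · have h4 := hM _ ⟨U, hU, hWU, rfl⟩
        exact ((eq_or_lt_of_le (inf_le_inf_left W h3)).resolve_right h4).ge
    · push Not at h
      obtain ⟨W', -, h2⟩ := exists_le_covBy_of_lt (bot_lt_iff_ne_bot.2 hW)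
      exact ⟨W', h2, fun U hU hWU => absurd (h U hU) hWU⟩
  obtain ⟨W', hcov, hZW'⟩ := hW'
  obtain ⟨s, hs, hspan, hU⟩ := ih W' hcov.lt
  -- The new basis vector is taken in the smallest `U ∈ 𝓑` whose trace leaves `W'`; it then lies in
  -- all larger members of `𝓑`.
  have hv : ∃ v ∈ W, v ∉ W' ∧ ∀ U ∈ 𝓑, ¬ W ⊓ U ≤ W' → v ∈ U := by
    by_cases h : ∃ U ∈ 𝓑, ¬ W ⊓ U ≤ W'
    · obtain ⟨U₁, ⟨hU₁, hWU₁⟩, hmin⟩ := wellFounded_lt.has_min {U | U ∈ 𝓑 ∧ ¬ W ⊓ U ≤ W'} h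
      obtain ⟨v, hv, hvW'⟩ := SetLike.not_le_iff_exists.1 hWU₁
      refine ⟨v, hv.1, hvW', fun U hU hWU => ?_⟩
      rcases hB.total hU hU₁ with h3 | h3
      · exact ((eq_or_lt_of_le h3).resolve_right (hmin U ⟨hU, hWU⟩)) ▸ hv.2
      · exact h3 hv.2
    · push Not at h
      obtain ⟨v, hv, hvW'⟩ := SetLike.not_le_iff_exists.1 hcov.lt.not_ge
      exact ⟨v, hv, hvW', fun U hU hWU => absurd (h U hU) hWU⟩
  obtain ⟨v, hvW, hvW', hvB⟩ := hv
  have hspan' : Submodule.span F (insert v s) = W := by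
    rw [Submodule.span_insert, hspan]
    refine (hcov.eq_or_eq le_sup_right (sup_le ?_ hcov.le)).resolve_left fun h => hvW' ?_
    · simpa using hvW
    · rw [← h]
      exact Submodule.mem_sup_left (Submodule.mem_span_singleton_self v)
  refine ⟨insert v s, hs.id_insert (by rwa [hspan]), hspan', fun U hUm => ?_⟩
  have hmono : W' ⊓ U ≤ Submodule.span F (insert v s ∩ U) :=
    (hU U hUm).trans (Submodule.span_mono (Set.inter_subset_inter_left _ (Set.subset_insert v s)))
  -- In the first case the set adapted to `W'` already works for `U`; in the second, `W ⊓ U` is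
  -- spanned by `v` and `W' ⊓ U`.
  have hcases : W ⊓ U ≤ W' ∨ v ∈ U := by
    rcases hUm with h | h
    · by_cases hWU : W ≤ U
      · exact .inr (hWU hvW)
      · exact .inl (hZW' U h hWU)
    · exact or_iff_not_imp_left.2 (hvB U h)
  rcases hcases with h | hvU
  · exact (le_inf h inf_le_right).trans hmono
  · rintro x ⟨hxW, hxU⟩
    rw [SetLike.mem_coe, ← hspan', Submodule.mem_span_insert, hspan] at hxW
    obtain ⟨a, z, hz, rfl⟩ := hxW
    refine Submodule.add_mem _ (Submodule.smul_mem _ _ (Submodule.subset_span ⟨.inl rfl, hvU⟩))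
      (hmono ⟨hz, ?_⟩)
    exact (U.add_mem_iff_right (U.smul_mem a hvU)).1 hxU

/-- Two chains of subspaces of a finite-dimensional subspace `W` have a common adapted basis. -/
theorem exists_adapted_set {𝒵 𝓑 : Set (Submodule F V)} (hZ : IsChain (· ≤ ·) 𝒵)
    (hB : IsChain (· ≤ ·) 𝓑) (W : Submodule F V) [FiniteDimensional F W]
    (hW : ∀ U ∈ 𝒵 ∪ 𝓑, U ≤ W) :
    ∃ s : Set V, s.Finite ∧ LinearIndepOn F id s ∧ s ⊆ W ∧
      ∀ U ∈ 𝒵 ∪ 𝓑, U = Submodule.span F (s ∩ U) := by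
  have hchain : ∀ 𝒞 : Set (Submodule F V), IsChain (· ≤ ·) 𝒞 →
      IsChain (· ≤ ·) ((fun U : Submodule F V => U.submoduleOf W) '' 𝒞) := by
    rintro 𝒞 h𝒞 _ ⟨U₁, h₁, rfl⟩ _ ⟨U₂, h₂, rfl⟩ -
    exact (h𝒞.total h₁ h₂).imp (fun h => Submodule.comap_mono h) fun h => Submodule.comap_mono h
  obtain ⟨s, hs, -, hU⟩ := exists_adapted_set_of_le (hchain _ hZ) (hchain _ hB) ⊤
  refine ⟨Subtype.val '' s, (LinearIndependent.setFinite (R := F) (b := s) hs).image _,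
    ?_, ?_, fun U hUm => le_antisymm (fun x hx => ?_) ?_⟩
  · refine LinearIndepOn.id_image (v := W.subtype) ?_
    exact LinearIndependent.map' (v := fun i : s => (i : W)) hs W.subtype W.ker_subtype
  · rintro _ ⟨x, -, rfl⟩
    exact x.2
  · have h := hU (U.submoduleOf W) (by
      rw [← Set.image_union]; exact Set.mem_image_of_mem _ hUm)
    have h2 := Submodule.mem_map_of_mem (f := W.subtype)
      (h (show (⟨x, hW U hUm hx⟩ : W) ∈ ⊤ ⊓ U.submoduleOf W from ⟨trivial, hx⟩))
    rw [Submodule.map_span] at h2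
    refine Submodule.span_mono ?_ h2
    rintro _ ⟨y, ⟨hy1, hy2⟩, rfl⟩
    exact ⟨⟨y, hy1, rfl⟩, hy2⟩
  · exact Submodule.span_le.2 Set.inter_subset_right

end Adapted

/-! ### Uniqueness of the multiset of intervals -/

section Uniqueness

variable {F : Type u} [Field F]

theorem PersistenceModule.IsIsomorphic.finrank_range_eq {V : PersistenceModule.{u, v} F}
    {W : PersistenceModule.{u, w} F} (h : V.IsIsomorphic W) {s t : ℝ} (hst : s ≤ t) :
    Module.finrank F (LinearMap.range (V.map hst)) =
      Module.finrank F (LinearMap.range (W.map hst)) := by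
  obtain ⟨e, he⟩ := h
  have h1 : LinearMap.range (W.map hst) =
      (LinearMap.range (V.map hst)).map (e t : V.V t →ₗ[F] W.V t) := by
    ext y
    constructor
    · rintro ⟨x, rfl⟩
      exact ⟨_, ⟨(e s).symm x, rfl⟩, by simp [he]⟩
    · rintro ⟨_, ⟨x, rfl⟩, rfl⟩
      exact ⟨e s x, (he s t hst x).symm⟩
  rw [h1]
  exact (LinearEquiv.finrank_map_eq (e t) _).symm

theorem finrank_range_directSum_intervalModule {κ : Type v} [Finite κ] (q : κ → DgmPoint)
    {s t : ℝ} (hst : s ≤ t) :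
    Module.finrank F (LinearMap.range
      ((PersistenceModule.directSum fun i => intervalModule F (q i)).map hst)) =
      Nat.card {i // (q i).1 ≤ s ∧ (t : EReal) < (q i).2} := by
  classical
  have := Fintype.ofFinite κ
  let A : Type v := {i // (q i).1 ≤ s ∧ (t : EReal) < (q i).2}
  have hA : ∀ i : A, (q i).Alive t := fun i => ⟨i.2.1.trans hst, i.2.2⟩
  have hA' : ∀ i : A, (q i).Alive s :=
    fun i => ⟨i.2.1, (EReal.coe_le_coe_iff.2 hst).trans_lt i.2.2⟩
  -- The inclusion of the coordinates whose interval contains both `s` and `t`; its range is that of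
  -- the structure map.
  let g : (A → F) →ₗ[F]
      (PersistenceModule.directSum fun i => intervalModule F (q i)).V t :=
    { toFun := fun x i => ⟨if h : (q i).1 ≤ s ∧ (t : EReal) < (q i).2 then x ⟨i, h⟩ else 0,
        fun h' => dif_neg fun h => h' (hA ⟨i, h⟩)⟩
      map_add' := fun x y => funext fun i => Subtype.ext <| by
        change _ = dite _ _ _ + dite _ _ _
        split_ifs <;> simp
      map_smul' := fun a x => funext fun i => Subtype.ext <| by
        change _ = a * dite _ _ _
        split_ifs <;> simp }
  have hg : ∀ (x : A → F) (i : A), (g x i.1).1 = x i := fun x i => dif_pos i.2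
  have hg0 : ∀ (x : A → F) (i : κ), ¬ ((q i).1 ≤ s ∧ (t : EReal) < (q i).2) → g x i = 0 :=
    fun x i hi => Subtype.ext (dif_neg hi)
  have hinj : Function.Injective g := fun x y hxy => funext fun i => by
    rw [← hg x i, hxy, hg y i]
  have hrange : LinearMap.range
      ((PersistenceModule.directSum fun i => intervalModule F (q i)).map hst) =
      LinearMap.range g := by
    ext y
    constructor
    · rintro ⟨x, rfl⟩
      refine ⟨fun i => (x i.1).1, funext fun i => Subtype.ext ?_⟩
      by_cases h : (q i).1 ≤ s ∧ (t : EReal) < (q i).2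
      · refine (hg _ ⟨i, h⟩).trans ?_
        exact (if_pos (hA ⟨i, h⟩)).symm
      · rw [hg0 _ i h]
        change (0 : F) = if (q i).Alive t then (x i).1 else 0
        split_ifs with h'
        · exact ((x i).2 fun h2 => h ⟨h2.1, h'.2⟩).symm
        · rfl
    · rintro ⟨x, rfl⟩
      refine ⟨fun i => ⟨(g x i).1, fun h => ?_⟩, funext fun i => Subtype.ext ?_⟩
      · rw [hg0 x i fun h2 => h (hA' ⟨i, h2⟩)]
        rfl
      · change (if (q i).Alive t then (g x i).1 else 0) = (g x i).1
        split_ifs with h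
        · rfl
        · exact ((g x i).2 h).symm
  rw [hrange, LinearMap.finrank_range_of_inj hinj, Module.finrank_fintype_fun_eq_card,
    Nat.card_eq_fintype_card]

open Classical in
theorem natCard_toType_subtype (D : Multiset DgmPoint) (P : DgmPoint → Prop)
    [DecidablePred P] :
    Nat.card {x : D.ToType // P x.1} = D.countP P := by
  conv_rhs => rw [← D.map_univ_coe, Multiset.countP_map]
  rw [Nat.card_eq_fintype_card, Fintype.card_subtype]
  rfl

open Classical in
theorem IsDiagram.countP_eq {V : PersistenceModule.{u, v} F} {D : Multiset DgmPoint}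
    (h : IsDiagram V D) {s t : ℝ} (hst : s ≤ t) :
    D.countP (fun p => p.1 ≤ s ∧ (t : EReal) < p.2) =
      Module.finrank F (LinearMap.range (V.map hst)) := by
  rw [h.2.finrank_range_eq hst, finrank_range_directSum_intervalModule,
    ← natCard_toType_subtype D fun p => p.1 ≤ s ∧ (t : EReal) < p.2]

open Classical in
/-- A finite multiset of nonempty intervals is determined by its rank function. -/
theorem eq_of_countP_eq {D D' : Multiset DgmPoint} (hD : ∀ p ∈ D, (p.1 : EReal) < p.2)
    (hD' : ∀ p ∈ D', (p.1 : EReal) < p.2)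
    (h : ∀ s t : ℝ, s ≤ t → D.countP (fun p => p.1 ≤ s ∧ (t : EReal) < p.2) =
      D'.countP (fun p => p.1 ≤ s ∧ (t : EReal) < p.2)) : D = D' := by
  -- Removing the common part leaves two disjoint multisets with equal rank functions; the claim is
  -- that both are empty.
  set E := D - D' with hE
  set E' := D' - D with hE'
  have hEE : ∀ s t : ℝ, s ≤ t → E.countP (fun p => p.1 ≤ s ∧ (t : EReal) < p.2) =
      E'.countP (fun p => p.1 ≤ s ∧ (t : EReal) < p.2) := by
    intro s t hst
    have h1 := h s t hst
    have h2 := congrArg (Multiset.countP fun p => p.1 ≤ s ∧ (t : EReal) < p.2)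
      (Multiset.sub_add_inter D D')
    have h3 := congrArg (Multiset.countP fun p => p.1 ≤ s ∧ (t : EReal) < p.2)
      (Multiset.sub_add_inter D' D)
    rw [Multiset.countP_add, ← hE] at h2
    rw [Multiset.countP_add, Multiset.inter_comm D' D, ← hE'] at h3
    omega
  have hEmpty : E + E' = 0 := by
    by_contra hne
    -- The point with the earliest birth and, among those, the latest death.
    obtain ⟨p, hp, hmin⟩ := Finset.exists_min_image (E + E').toFinset
      (fun p => toLex (p.1, OrderDual.toDual p.2)) (Multiset.toFinset_nonempty.2 hne)
    have hlt : (p.1 : EReal) < p.2 := by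
      rcases Multiset.mem_add.1 (Multiset.mem_toFinset.1 hp) with h1 | h1
      · exact hD p (Multiset.mem_of_le (Multiset.sub_le_self _ _) h1)
      · exact hD' p (Multiset.mem_of_le (Multiset.sub_le_self _ _) h1)
    -- With `t` above every death smaller than that of `p`, the only interval left that contains
    -- both `p.1` and `t` is `p`. The rank there is thus the multiplicity of `p`, which must agree
    -- in `E` and `E'`, although they are disjoint.
    obtain ⟨t, ht1, ht2⟩ := EReal.lt_iff_exists_real_btwn.1 (show
      (p.1 : EReal) ⊔ ((E + E').toFinset.filter fun r => r.2 < p.2).sup Prod.snd < p.2 from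
        max_lt hlt ((Finset.sup_lt_iff (bot_le.trans_lt hlt)).2 fun r hr =>
          (Finset.mem_filter.1 hr).2))
    have hpt : p.1 ≤ t := EReal.coe_le_coe_iff.1 (le_sup_left.trans ht1.le)
    have halive : ∀ r ∈ E + E', (r.1 ≤ p.1 ∧ (t : EReal) < r.2) = (r = p) := by
      intro r hr
      refine propext ⟨fun ⟨h1, h2⟩ => ?_, ?_⟩
      · have h3 : p.2 ≤ r.2 := by
          by_contra h4
          have h5 : r.2 ≤ ((E + E').toFinset.filter fun r => r.2 < p.2).sup Prod.snd :=
            Finset.le_sup (f := Prod.snd)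
              (Finset.mem_filter.2 ⟨Multiset.mem_toFinset.2 hr, not_le.1 h4⟩)
          exact absurd h2 (not_lt.2 (h5.trans (le_sup_right.trans ht1.le)))
        rcases Prod.Lex.le_iff.1 (hmin r (Multiset.mem_toFinset.2 hr)) with h4 | ⟨h4, h5⟩
        · exact absurd h4 (not_lt.2 h1)
        · exact Prod.ext h4.symm (le_antisymm h5 h3)
      · rintro rfl
        exact ⟨le_rfl, ht2⟩
    have h1 := hEE p.1 t hpt
    rw [Multiset.countP_congr rfl fun r hr => halive r (Multiset.mem_add.2 (.inl hr)),
      Multiset.countP_congr rfl fun r hr => halive r (Multiset.mem_add.2 (.inr hr))] at h1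
    have h2 : E.count p = E'.count p := by
      simpa only [Multiset.count, eq_comm] using h1
    have h3 : 0 < (E + E').count p := Multiset.count_pos.2 (Multiset.mem_toFinset.1 hp)
    rw [Multiset.count_add] at h3
    rw [hE, hE', Multiset.count_sub, Multiset.count_sub] at h2 h3
    omega
  have h1 : E = 0 ∧ E' = 0 := by simpa using hEmpty
  exact le_antisymm (tsub_eq_zero_iff_le.1 h1.1) (tsub_eq_zero_iff_le.1 h1.2)

theorem IsDiagram.unique {V : PersistenceModule.{u, v} F} {D D' : Multiset DgmPoint}
    (h : IsDiagram V D) (h' : IsDiagram V D') : D = D' :=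
  eq_of_countP_eq h.1 h'.1 fun _ _ hst => (h.countP_eq hst).trans (h'.countP_eq hst).symm

theorem IsDiagram.diagram_eq {V : PersistenceModule.{u, v} F} {D : Multiset DgmPoint}
    (h : IsDiagram V D) : diagram V = D := by
  have h' : ∃ D, IsDiagram V D := ⟨D, h⟩
  rw [diagram, dif_pos h']
  exact h'.choose_spec.unique h

theorem PersistenceModule.IsIsomorphic.isDiagram {V : PersistenceModule.{u, v} F}
    {W : PersistenceModule.{u, w} F} (h : V.IsIsomorphic W) {D : Multiset DgmPoint}
    (hD : IsDiagram W D) : IsDiagram V D := by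
  obtain ⟨e, he⟩ := h
  obtain ⟨e', he'⟩ := hD.2
  exact ⟨hD.1, fun t => (e t).trans (e' t), fun s t hst x => by simp [he, he']⟩

end Uniqueness

/-! ### Diagrams of filtrations -/

section Diagrams

open Classical in
/-- The nonempty intervals of a finite family, as a multiset indexed by a part of the family. -/
theorem exists_multiset_index {ι : Type w} [Finite ι] (p : ι → DgmPoint) :
    ∃ (D : Multiset DgmPoint) (j : D.ToType → ι), Function.Injective j ∧
      (∀ x, p (j x) = x.1) ∧ ∀ i, i ∈ Set.range j ↔ ((p i).1 : EReal) < (p i).2 := by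
  have := Fintype.ofFinite ι
  let s : Finset ι := Finset.univ.filter fun i => ((p i).1 : EReal) < (p i).2
  let e := s.val.mapEquiv p
  refine ⟨s.val.map p, fun x => (e.symm x).1, ?_, fun x => ?_, fun i => ?_⟩
  · have h : Function.Injective fun x : s.val.ToType => x.1 := by
      rintro ⟨x, a, ha⟩ ⟨y, b, hb⟩ (rfl : x = y)
      have := Multiset.nodup_iff_count_le_one.1 s.nodup x
      obtain rfl : a = b := by omega
      rfl
    exact h.comp e.symm.injective
  · exact (Multiset.mapEquiv_apply s.val p (e.symm x)).symm.trans
      (congrArg Sigma.fst (e.apply_symm_apply x))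
  · have hmem : i ∈ s ↔ ((p i).1 : EReal) < (p i).2 := by simp [s]
    rw [← hmem]
    constructor
    · rintro ⟨x, rfl⟩
      exact Multiset.coe_mem
    · intro h
      exact ⟨e ⟨i, 0, Multiset.count_pos.2 h⟩, congrArg Sigma.fst (e.symm_apply_apply _)⟩

variable {F : Type u} [Field F] {X : Type v}

open Classical in
/-- A family of chains adapted to the cycles and to the boundaries of the sublevel complexes of a
filtration decomposes its persistent homology into interval modules. -/
theorem isIsomorphic_directSum (f : Filtration X) (k : ℕ) {ι : Type*} {c : ι → Chain F X}
    (hc : LinearIndependent F c) (p : ι → DgmPoint)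
    (hZ : ∀ t, cycles F (f.sublevel t) k = Submodule.span F (c '' {i | (p i).1 ≤ t}))
    (hB : ∀ t : ℝ, boundaries F (f.sublevel t) k =
      Submodule.span F (c '' {i | (p i).2 ≤ (t : EReal)}))
    {κ : Type*} [Finite κ] {j : κ → ι} (hj : Function.Injective j)
    (hrange : ∀ i, ((p i).1 : EReal) < (p i).2 → i ∈ Set.range j) :
    (f.persistentHomology F k).IsIsomorphic
      (PersistenceModule.directSum fun x => intervalModule F (p (j x))) := by
  -- `φ` reads off coordinates with respect to the family `c`.
  obtain ⟨φ, hφ⟩ := LinearMap.exists_leftInverse_of_injective (Finsupp.linearCombination F c)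
    (LinearMap.ker_eq_bot.2 hc)
  replace hφ : ∀ l, φ (Finsupp.linearCombination F c l) = l := fun l => LinearMap.congr_fun hφ l
  have halive : ∀ i t, (p i).Alive t → i ∈ Set.range j := fun i t h =>
    hrange i ((EReal.coe_le_coe_iff.2 h.1).trans_lt h.2)
  let E : ∀ t, cycles F (f.sublevel t) k →ₗ[F]
      (PersistenceModule.directSum fun x => intervalModule F (p (j x))).V t := fun t =>
    { toFun := fun z x => ⟨if (p (j x)).Alive t then φ z (j x) else 0, fun h => if_neg h⟩
      map_add' := fun z z' => funext fun x => Subtype.ext <| by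
        change _ = ite _ _ _ + ite _ _ _
        split_ifs <;> simp
      map_smul' := fun a z => funext fun x => Subtype.ext <| by
        change _ = a * ite _ _ _
        split_ifs <;> simp }
  have hE : ∀ t z x, (E t z x).1 = if (p (j x)).Alive t then φ z (j x) else 0 :=
    fun _ _ _ => rfl
  have hker : ∀ t, LinearMap.ker (E t) =
      (boundaries F (f.sublevel t) k).submoduleOf (cycles F (f.sublevel t) k) := by
    intro t
    ext ⟨z, hz⟩
    rw [LinearMap.mem_ker]
    constructor
    · intro h
      rw [hZ t, Finsupp.mem_span_image_iff_linearCombination] at hz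
      obtain ⟨l, hl, rfl⟩ := hz
      change Finsupp.linearCombination F c l ∈ boundaries F (f.sublevel t) k
      rw [hB t, Finsupp.mem_span_image_iff_linearCombination]
      refine ⟨l, fun i hi => ?_, rfl⟩
      change (p i).2 ≤ (t : EReal)
      by_contra hd
      have hA : (p i).Alive t := ⟨hl hi, not_le.1 hd⟩
      obtain ⟨x, rfl⟩ := halive i t hA
      have h2 := congrArg Subtype.val (congrFun h x)
      rw [hE, if_pos hA] at h2
      change φ (Finsupp.linearCombination F c l) (j x) = 0 at h2
      rw [hφ] at h2
      exact Finsupp.mem_support_iff.1 hi h2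
    · intro h
      change z ∈ boundaries F (f.sublevel t) k at h
      rw [hB t, Finsupp.mem_span_image_iff_linearCombination] at h
      obtain ⟨l, hl, rfl⟩ := h
      refine funext fun x => Subtype.ext ?_
      rw [hE]
      split_ifs with hA
      · change φ (Finsupp.linearCombination F c l) (j x) = 0
        rw [hφ]
        by_contra hne
        exact absurd hA.2 (not_lt.2 (hl (Finsupp.mem_support_iff.2 hne)))
      · rfl
  have hsurj : ∀ t, Function.Surjective (E t) := by
    intro t y
    let l : ι →₀ F := Finsupp.mapDomain j (Finsupp.equivFunOnFinite.symm fun x => (y x).1)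
    have hl : ∀ x, l (j x) = (y x).1 := fun x => Finsupp.mapDomain_apply hj _ _
    refine ⟨⟨Finsupp.linearCombination F c l, ?_⟩, funext fun x => Subtype.ext ?_⟩
    · rw [hZ t, Finsupp.mem_span_image_iff_linearCombination]
      refine ⟨l, fun i hi => ?_, rfl⟩
      by_contra hne
      by_cases hi2 : i ∈ Set.range j
      · obtain ⟨x, rfl⟩ := hi2
        exact Finsupp.mem_support_iff.1 hi ((hl x).trans ((y x).2 fun hA => hne hA.1))
      · exact Finsupp.mem_support_iff.1 hi (Finsupp.mapDomain_of_notMem_range _ _ hi2)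
    · rw [hE]
      change (if _ then φ (Finsupp.linearCombination F c l) (j x) else 0) = _
      rw [hφ, hl]
      split_ifs with hA
      · rfl
      · exact ((y x).2 hA).symm
  refine ⟨fun t => LinearEquiv.ofBijective
    (Submodule.liftQ _ (E t) (hker t).ge) ⟨?_, ?_⟩, fun s t hst x => ?_⟩
  · rw [← LinearMap.ker_eq_bot]
    exact Submodule.ker_liftQ_eq_bot _ _ _ (hker t).le
  · intro y
    obtain ⟨z, rfl⟩ := hsurj t y
    exact ⟨Submodule.Quotient.mk z, rfl⟩
  · obtain ⟨⟨z, hz⟩, rfl⟩ := Submodule.Quotient.mk_surjective _ x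
    refine funext fun x => Subtype.ext ?_
    change (if (p (j x)).Alive t then φ z (j x) else 0) =
      if (p (j x)).Alive t then (if (p (j x)).Alive s then φ z (j x) else 0) else 0
    by_cases ht : (p (j x)).Alive t
    · by_cases hs : (p (j x)).Alive s
      · simp [ht, hs]
      -- Alive at `t` but not at `s ≤ t` means not yet born at `s`, so a cycle at `s` has zero
      -- coefficient there.
      · rw [hZ s, Finsupp.mem_span_image_iff_linearCombination] at hz
        obtain ⟨l, hl, rfl⟩ := hz
        rw [if_pos ht, if_pos ht, if_neg hs, hφ]
        by_contra hne
        exact hs ⟨hl (Finsupp.mem_support_iff.2 hne),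
          (EReal.coe_le_coe_iff.2 hst).trans_lt ht.2⟩
    · simp [ht]

open Classical in
-- Keeping the injection `j` into the index set of the chains is what later allows two diagrams
-- built from the same chains to be matched index by index.
theorem exists_isDiagram_index (f : Filtration X) (k : ℕ) {ι : Type*} [Finite ι]
    {c : ι → Chain F X} (hc : LinearIndependent F c) (p : ι → DgmPoint)
    (hZ : ∀ t, cycles F (f.sublevel t) k = Submodule.span F (c '' {i | (p i).1 ≤ t}))
    (hB : ∀ t : ℝ, boundaries F (f.sublevel t) k =
      Submodule.span F (c '' {i | (p i).2 ≤ (t : EReal)})) :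
    ∃ (D : Multiset DgmPoint) (j : D.ToType → ι), IsDiagram (f.persistentHomology F k) D ∧
      Function.Injective j ∧ (∀ x, p (j x) = x.1) ∧
      ∀ i, i ∈ Set.range j ↔ ((p i).1 : EReal) < (p i).2 := by
  obtain ⟨D, j, hj, hpj, hrange⟩ := exists_multiset_index p
  refine ⟨D, j, ⟨fun q hq => ?_, ?_⟩, hj, hpj, hrange⟩
  · let x : D.ToType := ⟨q, 0, Multiset.count_pos.2 hq⟩
    have h := (hrange (j x)).1 ⟨x, rfl⟩
    rwa [hpj] at h
  · have h := isIsomorphic_directSum f k hc p hZ hB hj fun i => (hrange i).2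
    simpa only [hpj] using h

theorem cycles_le_chains (K : PreAbstractSimplicialComplex X) (k : ℕ) :
    cycles F K k ≤ chains F K k := by
  cases k with
  | zero => exact le_rfl
  | succ k => exact inf_le_left

instance finiteDimensional_chains [Finite X] (K : PreAbstractSimplicialComplex X) (k : ℕ) :
    FiniteDimensional F (chains F K k) := by
  refine FiniteDimensional.span_of_finite F ((Set.finite_range
    (oriented F (n := k + 1) (X := X))).subset ?_)
  rintro _ ⟨x, -, rfl⟩
  exact ⟨x, rfl⟩

instance finiteDimensional_cycles [Finite X] (K : PreAbstractSimplicialComplex X) (k : ℕ) :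
    FiniteDimensional F (cycles F K k) :=
  Submodule.finiteDimensional_of_le (cycles_le_chains K k)

theorem chains_eq_bot {K : PreAbstractSimplicialComplex X} (hK : ∀ σ, σ ∉ K) (k : ℕ) :
    chains F K k = ⊥ := by
  rw [chains, Submodule.span_eq_bot]
  rintro _ ⟨x, ⟨σ, hσ, -⟩, -⟩
  exact absurd hσ (hK σ)

/-- The point of a diagram born with `σ` and dying with `τ` (never, if `τ` is `none`). -/
def Filtration.point (g : Filtration X) (σ : Finset X) (τ : Option (Finset X)) : DgmPoint :=
  (g σ, τ.elim ⊤ fun α => (g α : EReal))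

/-- A filtration of a finite set has a family of chains, with birth and death simplices, that
simultaneously decomposes the persistent homology of all its coarsenings. -/
theorem exists_adapted_chains [Finite X] (f : Filtration X) (k : ℕ) :
    ∃ (ι : Type (max u v)) (_ : Finite ι) (c : ι → Chain F X) (σ : ι → Finset X)
      (τ : ι → Option (Finset X)), LinearIndependent F c ∧
      ∀ g : Filtration X, (∀ α β, f α ≤ f β → g α ≤ g β) → ∀ t : ℝ,
        cycles F (g.sublevel t) k =
          Submodule.span F (c '' {i | (g.point (σ i) (τ i)).1 ≤ t}) ∧
        boundaries F (g.sublevel t) k =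
          Submodule.span F (c '' {i | (g.point (σ i) (τ i)).2 ≤ (t : EReal)}) := by
  classical
  have := Fintype.ofFinite X
  have hchain : ∀ U : PreAbstractSimplicialComplex X → Submodule F (Chain F X), Monotone U →
      IsChain (· ≤ ·) (Set.range fun β : Finset X => U (f.sublevel (f β))) := by
    rintro U hU _ ⟨α, rfl⟩ _ ⟨β, rfl⟩ -
    exact (le_total (f α) (f β)).imp (fun h => hU (f.sublevel_mono h))
      fun h => hU (f.sublevel_mono h)
  have htop : ∀ β, f.sublevel (f β) ≤ f.sublevel (f Finset.univ) :=
    fun β => f.sublevel_mono (f.monotone (Finset.subset_univ β))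
  obtain ⟨s, hsfin, hs, hsW, hU⟩ := exists_adapted_set
    (hchain (fun K => cycles F K k) fun _ _ h => cycles_mono F h k)
    (hchain (fun K => boundaries F K k) fun _ _ h => boundaries_mono F h k)
    (cycles F (f.sublevel (f Finset.univ)) k) (by
      rintro _ (⟨β, rfl⟩ | ⟨β, rfl⟩)
      · exact cycles_mono F (htop β) k
      · exact (boundaries_le_cycles F _ k).trans (cycles_mono F (htop β) k))
  -- Births and deaths are recorded as simplices rather than numbers, so that they keep their
  -- meaning when `f` is replaced by a coarsening.
  have hσ : ∀ x : s, ∃ σ : Finset X, ∀ β,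
      x.1 ∈ cycles F (f.sublevel (f β)) k ↔ f σ ≤ f β := by
    intro x
    obtain ⟨σ, hσ, hmin⟩ := Set.exists_min_image {β | x.1 ∈ cycles F (f.sublevel (f β)) k} f
      (Set.toFinite _) ⟨Finset.univ, hsW x.2⟩
    exact ⟨σ, fun β => ⟨hmin β, fun h => cycles_mono F (f.sublevel_mono h) k hσ⟩⟩
  have hτ : ∀ x : s, ∃ τ : Option (Finset X), ∀ β,
      x.1 ∈ boundaries F (f.sublevel (f β)) k ↔ ∃ α ∈ τ, f α ≤ f β := by
    intro x
    by_cases hne : {β | x.1 ∈ boundaries F (f.sublevel (f β)) k}.Nonempty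
    · obtain ⟨τ, hτ, hmin⟩ := Set.exists_min_image _ f (Set.toFinite _) hne
      exact ⟨some τ, fun β => ⟨fun h => ⟨τ, rfl, hmin β h⟩, by
        rintro ⟨_, ⟨⟩, h⟩
        exact boundaries_mono F (f.sublevel_mono h) k hτ⟩⟩
    · exact ⟨none, fun β => ⟨fun h => absurd ⟨β, h⟩ hne, by simp⟩⟩
  choose σ hσ using hσ
  choose τ hτ using hτ
  refine ⟨s, hsfin, fun x => x.1, σ, τ, hs, fun g hg t => ?_⟩
  have hpoint : ∀ x, (g.point (σ x) (τ x)).2 ≤ (t : EReal) ↔ ∃ α ∈ τ x, g α ≤ t := by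
    intro x
    rcases hx : τ x with _ | α <;> simp [Filtration.point]
  simp only [hpoint]
  change _ = Submodule.span F (_ '' {x | g (σ x) ≤ t}) ∧ _
  by_cases hne : {β | g β ≤ t}.Nonempty
  -- Every nonempty sublevel set of a coarsening `g` is a sublevel set of `f`, at the largest value
  -- of `f` on it.
  · obtain ⟨β, hβ, hmax⟩ := Set.exists_max_image {β | g β ≤ t} f (Set.toFinite _) hne
    have hle : ∀ α, g α ≤ t ↔ f α ≤ f β :=
      fun α => ⟨hmax α, fun h => (hg _ _ h).trans hβ⟩
    have heq : g.sublevel t = f.sublevel (f β) := by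
      refine SetLike.ext fun α => ?_
      exact and_congr_right fun _ => hle α
    rw [heq]
    simp only [hle, ← hσ, ← hτ]
    have himage : ∀ U : Submodule F (Chain F X), (fun x : s => x.1) '' {x | x.1 ∈ U} = s ∩ U :=
      fun U => Subtype.image_preimage_coe s U
    rw [himage, himage]
    exact ⟨hU _ (.inl ⟨β, rfl⟩), hU _ (.inr ⟨β, rfl⟩)⟩
  · have hne' : ∀ β, ¬ g β ≤ t := fun β h => hne ⟨β, h⟩
    have hZ : cycles F (g.sublevel t) k ≤ ⊥ :=
      (cycles_le_chains _ k).trans (chains_eq_bot (K := g.sublevel t) (fun α h => hne' α h.2) k).le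
    simp only [hne', and_false, exists_false, Set.ofPred_false, Set.image_empty,
      Submodule.span_empty]
    exact ⟨le_bot_iff.1 hZ, le_bot_iff.1 ((boundaries_le_cycles F _ k).trans hZ)⟩

variable (F) in
theorem exists_isDiagram [Finite X] (f : Filtration X) (k : ℕ) :
    ∃ D, IsDiagram (f.persistentHomology F k) D := by
  obtain ⟨ι, _, c, σ, τ, hc, h⟩ := exists_adapted_chains (F := F) f k
  obtain ⟨D, -, hD, -⟩ := exists_isDiagram_index f k hc (fun i => f.point (σ i) (τ i))
    (fun t => (h f (fun _ _ => id) t).1) (fun t => (h f (fun _ _ => id) t).2)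
  exact ⟨D, hD⟩

variable (F) in
theorem isDiagram_diagram [Finite X] (f : Filtration X) (k : ℕ) :
    IsDiagram (f.persistentHomology F k) (diagram (f.persistentHomology F k)) := by
  obtain ⟨D, hD⟩ := exists_isDiagram F f k
  rwa [hD.diagram_eq]

end Diagrams

/-! ### Matchings of diagrams -/

section Matchings

theorem deathDist_coe_coe (x y : ℝ) : deathDist x y = edist x y := by
  rw [deathDist, edist_dist, Real.dist_eq]
  split_ifs with h
  · simp [EReal.coe_eq_coe_iff.1 h]
  · rw [← EReal.coe_sub, EReal.abs_def]

@[simp]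
theorem deathDist_self (d : EReal) : deathDist d d = 0 := if_pos rfl

theorem deathDist_comm (d d' : EReal) : deathDist d d' = deathDist d' d := by
  induction d <;> induction d' <;> first | rfl | skip
  all_goals rw [deathDist_coe_coe, deathDist_coe_coe, edist_comm]

theorem deathDist_triangle (d₁ d₂ d₃ : EReal) :
    deathDist d₁ d₃ ≤ deathDist d₁ d₂ + deathDist d₂ d₃ := by
  induction d₁ <;> induction d₂ <;> induction d₃
  all_goals first
    | (simp only [deathDist_coe_coe]; exact edist_triangle _ _ _)
    | simp [deathDist]

namespace DgmPoint

theorem supDist_comm (p q : DgmPoint) : p.supDist q = q.supDist p := by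
  rw [supDist, supDist, edist_comm, deathDist_comm]

theorem supDist_triangle (p q r : DgmPoint) : p.supDist r ≤ p.supDist q + q.supDist r :=
  max_le ((edist_triangle _ _ _).trans (add_le_add (le_max_left _ _) (le_max_left _ _)))
    ((deathDist_triangle _ _ _).trans (add_le_add (le_max_right _ _) (le_max_right _ _)))

theorem pers_le (p q : DgmPoint) : p.pers ≤ 2 * p.supDist q + q.pers := by
  obtain ⟨b, d⟩ := p
  obtain ⟨b', d'⟩ := q
  have h : edist b b' + deathDist d d' ≤ 2 * supDist (b, d) (b', d') := by
    rw [two_mul]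
    exact add_le_add (le_max_left _ _) (le_max_right _ _)
  refine le_trans ?_ (add_le_add_left h _)
  induction d
  · simp [pers]
  · rename_i d
    induction d'
    · simp [deathDist]
    · rename_i d'
      rw [deathDist_coe_coe, edist_dist, edist_dist, pers, pers, ← EReal.coe_sub,
        ← EReal.coe_sub, EReal.toENNReal_of_ne_top (EReal.coe_ne_top _),
        EReal.toENNReal_of_ne_top (EReal.coe_ne_top _), EReal.toReal_coe, EReal.toReal_coe,
        ← ENNReal.ofReal_add dist_nonneg dist_nonneg]
      refine le_trans (ENNReal.ofReal_le_ofReal ?_) ENNReal.ofReal_add_le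
      rw [Real.dist_eq, Real.dist_eq]
      linarith [neg_abs_le (b - b'), le_abs_self (d - d')]
    · simp [deathDist]
  · induction d' <;> simp [deathDist, pers]

/-- This lets matchings compose: a point whose partner is later left unmatched can itself be left
unmatched at the sum of the two costs. -/
theorem half_pers_le (p q : DgmPoint) : p.pers / 2 ≤ p.supDist q + q.pers / 2 := by
  refine (ENNReal.div_le_div_right (p.pers_le q) 2).trans_eq ?_
  rw [ENNReal.add_div, mul_comm, ENNReal.mul_div_cancel_right two_ne_zero ENNReal.ofNat_ne_top]

theorem pers_eq_zero {p : DgmPoint} (h : ¬ (p.1 : EReal) < p.2) : p.pers = 0 :=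
  EReal.toENNReal_of_nonpos (EReal.sub_nonpos.2 (not_lt.1 h))

end DgmPoint

variable {A B C : Type}

/-- The cost of a partial bijection between two families of points is at most `ε`. -/
def MatchingLE (P : A → DgmPoint) (Q : B → DgmPoint) (ε : ℝ≥0∞) (m : A ≃. B) : Prop :=
  (∀ a b, b ∈ m a → (P a).supDist (Q b) ≤ ε) ∧ (∀ a, m a = none → (P a).pers / 2 ≤ ε) ∧
    ∀ b, m.symm b = none → (Q b).pers / 2 ≤ ε

variable {P : A → DgmPoint} {Q : B → DgmPoint} {R : C → DgmPoint} {ε ε' : ℝ≥0∞}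

theorem MatchingLE.mono {m : A ≃. B} (h : MatchingLE P Q ε m) (hε : ε ≤ ε') :
    MatchingLE P Q ε' m :=
  ⟨fun a b hab => (h.1 a b hab).trans hε, fun a ha => (h.2.1 a ha).trans hε,
    fun b hb => (h.2.2 b hb).trans hε⟩

theorem MatchingLE.symm {m : A ≃. B} (h : MatchingLE P Q ε m) : MatchingLE Q P ε m.symm :=
  ⟨fun b a hab => (DgmPoint.supDist_comm _ _).trans_le (h.1 a b (m.mem_iff_mem.1 hab)),
    h.2.2, h.2.1⟩

theorem MatchingLE.trans {m : A ≃. B} {n : B ≃. C} (h : MatchingLE P Q ε m)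
    (h' : MatchingLE Q R ε' n) : MatchingLE P R (ε + ε') (m.trans n) := by
  refine ⟨fun a c hac => ?_, fun a ha => ?_, fun c hc => ?_⟩
  · obtain ⟨b, hab, hbc⟩ := (m.mem_trans n a c).1 hac
    exact (DgmPoint.supDist_triangle _ _ _).trans (add_le_add (h.1 a b hab) (h'.1 b c hbc))
  · rcases hm : m a with _ | b
    · exact (h.2.1 a hm).trans le_self_add
    · have hn : n b = none := by simpa [PEquiv.trans, hm] using ha
      exact (DgmPoint.half_pers_le _ _).trans (add_le_add (h.1 a b hm) (h'.2.1 b hn))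
  · rcases hn : n.symm c with _ | b
    · exact (h'.2.2 c hn).trans le_add_self
    · have hm : m.symm b = none := by
        rw [PEquiv.symm_trans_rev] at hc
        simpa [PEquiv.trans, hn] using hc
      rw [add_comm]
      refine (DgmPoint.half_pers_le _ _).trans (add_le_add ?_ (h.2.2 b hm))
      rw [DgmPoint.supDist_comm]
      exact h'.1 b c (n.mem_iff_mem.1 hn)

/-- There are only finitely many partial bijections, so the least cost is attained. This supplies
the passage to the limit in the motion along the segment. -/
theorem exists_matchingLE_of_forall [Finite A] [Finite B]
    (h : ∀ η : ℝ, 0 < η → ∃ m, MatchingLE P Q (ε + ENNReal.ofReal η) m) :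
    ∃ m, MatchingLE P Q ε m := by
  let cost (m : A ≃. B) : ℝ≥0∞ := sInf {ε | MatchingLE P Q ε m}
  have hcost : ∀ m, MatchingLE P Q (cost m) m := fun m =>
    ⟨fun a b hab => le_sInf fun _ h => h.1 a b hab, fun a ha => le_sInf fun _ h => h.2.1 a ha,
      fun b hb => le_sInf fun _ h => h.2.2 b hb⟩
  have : Finite (A ≃. B) := Finite.of_injective (fun m a => m a) DFunLike.coe_injective
  obtain ⟨m, hm⟩ := Finite.exists_min cost
  refine ⟨m, (hcost m).mono (ENNReal.le_of_forall_pos_le_add fun η hη _ => ?_)⟩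
  obtain ⟨m', hm'⟩ := h η hη
  rw [ENNReal.ofReal_coe_nnreal] at hm'
  exact (hm m').trans (sInf_le hm')

theorem MatchingLE.exists_matchingCost_le {m : A ≃. B} (h : MatchingLE P Q ε m) :
    ∃ (B₁ : Set A) (B₂ : Set B) (φ : B₁ ≃ B₂), matchingCost P Q φ ≤ ε := by
  have hsymm : ∀ a (ha : (m a).isSome), m.symm ((m a).get ha) = some a := fun a ha =>
    m.mem_iff_mem.2 (Option.get_mem ha)
  have hsymm' : ∀ b (hb : (m.symm b).isSome), m ((m.symm b).get hb) = some b := fun b hb =>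
    m.mem_iff_mem.1 (Option.get_mem hb)
  refine ⟨{a | (m a).isSome}, {b | (m.symm b).isSome},
    { toFun := fun a => ⟨(m a.1).get a.2, by
        rw [Set.mem_ofPred_eq, hsymm]; rfl⟩
      invFun := fun b => ⟨(m.symm b.1).get b.2, by
        rw [Set.mem_ofPred_eq, hsymm']; rfl⟩
      left_inv := fun a => Subtype.ext (by simp [hsymm])
      right_inv := fun b => Subtype.ext (by simp [hsymm']) }, ?_⟩
  refine max_le (iSup_le fun a => h.1 _ _ (Option.get_mem a.2))
    (max_le (iSup_le fun a => h.2.1 _ ?_) (iSup_le fun b => h.2.2 _ ?_))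
  · exact Option.not_isSome_iff_eq_none.1 a.2
  · exact Option.not_isSome_iff_eq_none.1 b.2

open Classical in
theorem bottleneckDist_le {D D' : Multiset DgmPoint} {m : D.ToType ≃. D'.ToType}
    (h : MatchingLE (fun a : D.ToType => a.1) (fun b : D'.ToType => b.1) ε m) :
    bottleneckDist D D' ≤ ε := by
  obtain ⟨B₁, B₂, φ, hφ⟩ := h.exists_matchingCost_le
  rw [bottleneckDist]
  exact iInf₂_le_of_le B₁ B₂ (iInf_le_of_le φ hφ)

open Classical in
/-- Two subfamilies of nonempty intervals of families of points at distance at most `ε`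
have a matching of cost at most `ε`. -/
theorem exists_matchingLE_of_index {ι : Type w} {p q : ι → DgmPoint}
    (hpq : ∀ i, (p i).supDist (q i) ≤ ε) {j : A → ι} (hj : Function.Injective j)
    (hpj : ∀ a, p (j a) = P a) (hp : ∀ i, i ∈ Set.range j ↔ ((p i).1 : EReal) < (p i).2)
    {j' : B → ι} (hj' : Function.Injective j') (hqj : ∀ b, q (j' b) = Q b)
    (hq : ∀ i, i ∈ Set.range j' ↔ ((q i).1 : EReal) < (q i).2) :
    ∃ m, MatchingLE P Q ε m := by
  -- Points are matched exactly when they come from the same index.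
  let m : A ≃. B :=
    { toFun := fun a => if h : ∃ b, j' b = j a then some h.choose else none
      invFun := fun b => if h : ∃ a, j a = j' b then some h.choose else none
      inv := fun a b => by
        have h1 : (if h : ∃ a, j a = j' b then some h.choose else none) = some a ↔
            j a = j' b := by
          split_ifs with h
          · rw [Option.some_inj]
            exact ⟨fun h2 => h2 ▸ h.choose_spec, fun h2 => hj (h.choose_spec.trans h2.symm)⟩
          · exact ⟨by simp, fun h2 => absurd ⟨a, h2⟩ h⟩
        have h2 : (if h : ∃ b, j' b = j a then some h.choose else none) = some b ↔
            j' b = j a := by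
          split_ifs with h
          · rw [Option.some_inj]
            exact ⟨fun h2 => h2 ▸ h.choose_spec, fun h2 => hj' (h.choose_spec.trans h2.symm)⟩
          · exact ⟨by simp, fun h2 => absurd ⟨b, h2⟩ h⟩
        exact h1.trans (eq_comm.trans h2.symm) }
  have hm : ∀ a b, b ∈ m a → j' b = j a := by
    intro a b hab
    by_cases h : ∃ b, j' b = j a
    · have h1 : m a = some h.choose := dif_pos h
      rw [h1, Option.mem_some_iff] at hab
      exact hab ▸ h.choose_spec
    · have h1 : m a = none := dif_neg h
      simp [h1] at hab
  -- If the interval of index `i` is empty in the other family, the point there has persistence `0`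
  -- and lies within `ε`, so half the persistence is at most `ε`.
  have hunmatched : ∀ {p q : DgmPoint}, p.supDist q ≤ ε → ¬ (q.1 : EReal) < q.2 →
      p.pers / 2 ≤ ε := by
    intro p q h h'
    simpa [DgmPoint.pers_eq_zero h'] using (p.half_pers_le q).trans (add_le_add_left h _)
  refine ⟨m, fun a b hab => ?_, fun a ha => ?_, fun b hb => ?_⟩
  · rw [← hpj, ← hqj, hm a b hab]
    exact hpq _
  · rw [← hpj]
    refine hunmatched (hpq (j a)) fun h => ?_
    have h1 : ∃ b, j' b = j a := (hq _).2 h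
    exact absurd ((dif_pos h1).symm.trans ha) (by simp)
  · rw [← hqj]
    refine hunmatched ((DgmPoint.supDist_comm _ _).trans_le (hpq (j' b))) fun h => ?_
    have h1 : ∃ a, j a = j' b := (hp _).2 h
    exact absurd ((dif_pos h1).symm.trans hb) (by simp)

end Matchings

/-! ### Stability under perturbations of a filtration -/

section Stability

open Classical in
/-- The diagrams `D` and `D'` have a matching of cost at most `ε`. -/
def DiagramsWithin (ε : ℝ≥0∞) (D D' : Multiset DgmPoint) : Prop :=
  ∃ m : D.ToType ≃. D'.ToType, MatchingLE (fun a : D.ToType => a.1) (fun b : D'.ToType => b.1) ε m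

theorem DiagramsWithin.mono {ε ε' : ℝ≥0∞} {D D' : Multiset DgmPoint} (h : DiagramsWithin ε D D')
    (hε : ε ≤ ε') : DiagramsWithin ε' D D' :=
  h.imp fun _ hm => hm.mono hε

theorem DiagramsWithin.symm {ε : ℝ≥0∞} {D D' : Multiset DgmPoint} (h : DiagramsWithin ε D D') :
    DiagramsWithin ε D' D :=
  h.elim fun _ hm => ⟨_, hm.symm⟩

theorem DiagramsWithin.trans {ε ε' : ℝ≥0∞} {D D' D'' : Multiset DgmPoint}
    (h : DiagramsWithin ε D D') (h' : DiagramsWithin ε' D' D'') :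
    DiagramsWithin (ε + ε') D D'' :=
  h.elim fun _ hm => h'.elim fun _ hm' => ⟨_, hm.trans hm'⟩

theorem Filtration.supDist_point_le {X : Type v} {f g : Filtration X} {ε : ℝ}
    (h : ∀ α, |f α - g α| ≤ ε) (σ : Finset X) (τ : Option (Finset X)) :
    (f.point σ τ).supDist (g.point σ τ) ≤ ENNReal.ofReal ε := by
  have h' : ∀ α, edist (f α) (g α) ≤ ENNReal.ofReal ε := fun α => by
    rw [edist_dist, Real.dist_eq]
    exact ENNReal.ofReal_le_ofReal (h α)
  refine max_le (h' σ) ?_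
  rcases τ with _ | τ
  · simp [Filtration.point]
  · simpa [Filtration.point, deathDist_coe_coe] using h' τ

variable (F : Type u) [Field F] {X : Type v} [Finite X]

/-- The same chains decompose both filtrations, and the points of index `i` are the values of `f`
and of `g` at the same birth and death simplices. -/
theorem diagramsWithin_of_coarser {f g : Filtration X} (hfg : ∀ α β, f α ≤ f β → g α ≤ g β)
    {ε : ℝ} (h : ∀ α, |f α - g α| ≤ ε) (k : ℕ) :
    DiagramsWithin (ENNReal.ofReal ε) (diagram (f.persistentHomology F k))
      (diagram (g.persistentHomology F k)) := by
  obtain ⟨ι, _, c, σ, τ, hc, hZB⟩ := exists_adapted_chains (F := F) f k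
  obtain ⟨D, j, hD, hj, hpj, hp⟩ := exists_isDiagram_index f k hc (fun i => f.point (σ i) (τ i))
    (fun t => (hZB f (fun _ _ => id) t).1) (fun t => (hZB f (fun _ _ => id) t).2)
  obtain ⟨D', j', hD', hj', hqj, hq⟩ := exists_isDiagram_index g k hc
    (fun i => g.point (σ i) (τ i)) (fun t => (hZB g hfg t).1) (fun t => (hZB g hfg t).2)
  rw [hD.diagram_eq, hD'.diagram_eq]
  exact exists_matchingLE_of_index (fun i => Filtration.supDist_point_le h (σ i) (τ i))
    hj hpj hp hj' hqj hq

/-- The convex combination `(1 - t) f + t g` of two filtrations. -/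
def Filtration.interp {X : Type v} (f g : Filtration X) {t : ℝ} (ht : t ∈ Set.Icc (0 : ℝ) 1) :
    Filtration X where
  toFun σ := (1 - t) * f σ + t * g σ
  monotone' _ _ h := add_le_add (mul_le_mul_of_nonneg_left (f.monotone h) (sub_nonneg.2 ht.2))
    (mul_le_mul_of_nonneg_left (g.monotone h) ht.1)

/-- A strict inequality between two values at `t` persists nearby, and there are finitely many pairs
of simplices. Ties at `t` may break, so the combination at `t` is a coarsening of the one at `s`,
not conversely. -/
theorem eventually_coarser {X : Type v} [Finite X] (f g : Finset X → ℝ) (t : ℝ) :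
    ∀ᶠ s in nhds t, ∀ α β, (1 - s) * f α + s * g α ≤ (1 - s) * f β + s * g β →
      (1 - t) * f α + t * g α ≤ (1 - t) * f β + t * g β := by
  refine Filter.eventually_all.2 fun α => Filter.eventually_all.2 fun β => ?_
  by_cases h : (1 - t) * f α + t * g α ≤ (1 - t) * f β + t * g β
  · exact .of_forall fun _ _ => h
  · have hcont : ∀ γ, ContinuousAt (fun s : ℝ => (1 - s) * f γ + s * g γ) t := fun γ => by fun_prop
    filter_upwards [(hcont β).eventually_lt (hcont α) (not_le.1 h)] with s hs hs'
    exact absurd hs' (not_le.2 hs)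

theorem diagramsWithin_of_abs_sub_le (f g : Filtration X) {ε : ℝ} (hε : 0 ≤ ε)
    (h : ∀ α, |f α - g α| ≤ ε) (k : ℕ) :
    DiagramsWithin (ENNReal.ofReal ε) (diagram (f.persistentHomology F k))
      (diagram (g.persistentHomology F k)) := by
  let D {t : ℝ} (ht : t ∈ Set.Icc (0 : ℝ) 1) : Multiset DgmPoint :=
    diagram ((f.interp g ht).persistentHomology F k)
  have h0 : (0 : ℝ) ∈ Set.Icc (0 : ℝ) 1 := by simp
  have h1 : (1 : ℝ) ∈ Set.Icc (0 : ℝ) 1 := by simp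
  have hlocal : ∀ (t : ℝ) (ht : t ∈ Set.Icc (0 : ℝ) 1), ∀ᶠ s in nhds t,
      ∀ hs : s ∈ Set.Icc (0 : ℝ) 1, DiagramsWithin (ENNReal.ofReal (|s - t| * ε)) (D hs) (D ht) := by
    intro t ht
    filter_upwards [eventually_coarser f g t] with s hst hs
    refine diagramsWithin_of_coarser F hst (fun α => ?_) k
    have h2 : (f.interp g hs) α - (f.interp g ht) α = (s - t) * -(f α - g α) := by
      change ((1 - s) * f α + s * g α) - ((1 - t) * f α + t * g α) = _
      ring
    rw [h2, abs_mul, abs_neg]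
    exact mul_le_mul_of_nonneg_left (h α) (abs_nonneg _)
  -- Continuous induction on `[0, 1]`: `S` contains `0`, is closed, and reaches further to the right
  -- from each of its points below `1`.
  let S : Set ℝ := {t | ∃ ht : t ∈ Set.Icc (0 : ℝ) 1,
    DiagramsWithin (ENNReal.ofReal (t * ε)) (D h0) (D ht)}
  have hclosed : IsClosed (S ∩ Set.Icc 0 1) := by
    rw [isClosed_iff_frequently]
    intro t hfreq
    have ht : t ∈ Set.Icc (0 : ℝ) 1 :=
      isClosed_Icc.mem_of_frequently_of_tendsto (hfreq.mono fun _ h => h.2) Filter.tendsto_id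
    refine ⟨⟨ht, exists_matchingLE_of_forall fun η hη => ?_⟩, ht⟩
    have hcont : ContinuousAt (fun s : ℝ => s * ε + |s - t| * ε) t := by fun_prop
    have hlt : ∀ᶠ s in nhds t, s * ε + |s - t| * ε < t * ε + η :=
      hcont.eventually_lt continuousAt_const (by simpa using hη)
    -- A point of `S` close to `t` on either side: the detour through `s` costs at most `η` more
    -- than `t * ε`.
    obtain ⟨s, ⟨⟨hs, hS⟩, -⟩, hs1, hs2⟩ := (hfreq.and_eventually ((hlocal t ht).and hlt)).exists
    refine (hS.trans (hs1 hs)).mono ?_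
    rw [← ENNReal.ofReal_add (mul_nonneg hs.1 hε) (mul_nonneg (abs_nonneg _) hε),
      ← ENNReal.ofReal_add (mul_nonneg ht.1 hε) hη.le]
    exact ENNReal.ofReal_le_ofReal hs2.le
  have hzero : (0 : ℝ) ∈ S := by
    refine ⟨h0, ?_⟩
    have := diagramsWithin_of_coarser F (f := f.interp g h0) (g := f.interp g h0)
      (fun _ _ => id) (ε := 0 * ε) (by simp) k
    exact this
  have hstep : ∀ x ∈ S ∩ Set.Ico 0 1, ∀ y ∈ Set.Ioi x, (S ∩ Set.Ioc x y).Nonempty := by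
    rintro x ⟨⟨hx, hS⟩, hx'⟩ y hy
    obtain ⟨s, hs1, hs2⟩ := (((hlocal x hx).filter_mono nhdsWithin_le_nhds).and
      (Ioo_mem_nhdsGT (lt_min hx'.2 hy))).exists
    have hs : s ∈ Set.Icc (0 : ℝ) 1 :=
      ⟨hx.1.trans hs2.1.le, (hs2.2.trans_le (min_le_left _ _)).le⟩
    refine ⟨s, ⟨hs, (hS.trans (hs1 hs).symm).mono ?_⟩, hs2.1,
      (hs2.2.trans_le (min_le_right _ _)).le⟩
    rw [← ENNReal.ofReal_add (mul_nonneg hx.1 hε) (mul_nonneg (abs_nonneg _) hε),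
      abs_of_pos (sub_pos.2 hs2.1)]
    exact ENNReal.ofReal_le_ofReal (by linarith)
  obtain ⟨ht, hS⟩ := hclosed.Icc_subset_of_forall_exists_gt hzero hstep h1
  have e0 : f.interp g h0 = f := by ext; simp [Filtration.interp]
  have e1 : f.interp g h1 = g := by ext; simp [Filtration.interp]
  simpa only [D, e0, e1, one_mul] using hS

end Stability

/-! ### Pullbacks of filtrations -/

section Pullback

variable (F : Type u) [Field F] {X : Type v} {Y : Type w} {Z : Type*}

/-- The chain map induced by a map of vertices. -/
def push (φ : X → Y) : Chain F X →ₐ[F] Chain F Y :=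
  ExteriorAlgebra.map (Finsupp.lmapDomain F F φ)

theorem push_oriented (φ : X → Y) {n : ℕ} (x : Fin n → X) :
    push F φ (oriented F x) = oriented F (φ ∘ x) := by
  rw [push, oriented, ExteriorAlgebra.map_apply_ιMulti, oriented]
  congr 1
  ext1 i
  simp

theorem push_id (c : Chain F X) : push F id c = c := by
  rw [push, Finsupp.lmapDomain_id, ExteriorAlgebra.map_id, AlgHom.id_apply]

theorem push_push (φ : X → Y) (ψ : Y → Z) (c : Chain F X) :
    push F ψ (push F φ c) = push F (ψ ∘ φ) c := by
  rw [push, push, push, Finsupp.lmapDomain_comp, ← ExteriorAlgebra.map_comp_map,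
    AlgHom.comp_apply]

theorem ι_mul_oriented (w : X) {n : ℕ} (x : Fin n → X) :
    ExteriorAlgebra.ι F (Finsupp.single w (1 : F)) * oriented F x =
      oriented F (Fin.cons w x : Fin (n + 1) → X) := by
  rw [oriented, oriented, ExteriorAlgebra.ιMulti_succ_apply]
  rfl

theorem boundary_ι_mul (w : X) (c : Chain F X) :
    boundary F (ExteriorAlgebra.ι F (Finsupp.single w (1 : F)) * c) =
      c - ExteriorAlgebra.ι F (Finsupp.single w (1 : F)) * boundary F c := by
  refine (CliffordAlgebra.contractLeft_ι_mul _ _ _).trans ?_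
  simp
  rfl

variable {F} {K : PreAbstractSimplicialComplex X} {L : PreAbstractSimplicialComplex Y} {k : ℕ}

theorem oriented_mem_chains {x : Fin (k + 1) → X} {σ : Finset X} (hσ : σ ∈ K)
    (hx : Set.range x ⊆ σ) : oriented F x ∈ chains F K k := by
  classical
  refine Submodule.subset_span ⟨x, ⟨Finset.univ.image x, ?_, by simp⟩, rfl⟩
  refine (K.isRelLowerSet_faces hσ).2 ?_ (by simp)
  rw [← Finset.coe_subset]
  simpa using hx

theorem chains_induction {p : Submodule F (Chain F X)}
    (h : ∀ (x : Fin (k + 1) → X) (σ : Finset X), σ ∈ K → (σ : Set X) = Set.range x →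
      oriented F x ∈ p) : chains F K k ≤ p := by
  refine Submodule.span_le.2 ?_
  rintro _ ⟨x, ⟨σ, hσ, hx⟩, rfl⟩
  exact h x σ hσ hx

theorem boundary_push (φ : X → Y) {c : Chain F X} (hc : c ∈ chains F K k) :
    boundary F (push F φ c) = push F φ (boundary F c) := by
  refine chains_induction (p := LinearMap.eqLocus (boundary F ∘ₗ (push F φ).toLinearMap)
    ((push F φ).toLinearMap ∘ₗ boundary F)) (fun x _ _ _ => ?_) hc
  change boundary F (push F φ (oriented F x)) = push F φ (boundary F (oriented F x))
  rw [push_oriented, boundary_oriented, boundary_oriented, map_sum]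
  refine Finset.sum_congr rfl fun i _ => ?_
  rw [map_smul, push_oriented]
  rfl

/-- Only degree `0` needs an argument: homology is unreduced, so the algebraic boundary of a
`0`-cycle may be a nonzero multiple of the empty simplex, which every vertex map fixes. -/
theorem push_boundary_of_mem_cycles (φ : X → X) {c : Chain F X} (hc : c ∈ cycles F K k) :
    push F φ (boundary F c) = boundary F c := by
  cases k with
  | zero =>
    refine chains_induction (p := LinearMap.eqLocus ((push F φ).toLinearMap ∘ₗ boundary F)
      (boundary F)) (fun x _ _ _ => ?_) (cycles_le_chains _ _ hc)
    change push F φ (boundary F (oriented F x)) = boundary F (oriented F x)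
    rw [boundary_oriented, map_sum]
    refine Finset.sum_congr rfl fun i _ => ?_
    rw [map_smul, push_oriented]
    congr 2
    exact Subsingleton.elim _ _
  | succ k =>
    have h : boundary F c = 0 := hc.2
    rw [h, map_zero]

theorem push_mem_chains [DecidableEq Y] {φ : X → Y} (hφ : ∀ σ ∈ K, σ.image φ ∈ L)
    {c : Chain F X} (hc : c ∈ chains F K k) : push F φ c ∈ chains F L k := by
  refine chains_induction (p := (chains F L k).comap (push F φ).toLinearMap)
    (fun x σ hσ hx => ?_) hc
  change push F φ (oriented F x) ∈ chains F L k
  rw [push_oriented]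
  refine oriented_mem_chains (hφ σ hσ) ?_
  rw [Finset.coe_image, hx, Set.range_comp]

theorem push_mem_cycles [DecidableEq Y] {φ : X → Y} (hφ : ∀ σ ∈ K, σ.image φ ∈ L)
    {c : Chain F X} (hc : c ∈ cycles F K k) : push F φ c ∈ cycles F L k := by
  have hc' := cycles_le_chains _ _ hc
  cases k with
  | zero => exact push_mem_chains hφ hc'
  | succ k =>
    refine ⟨push_mem_chains hφ hc', ?_⟩
    have h : boundary F c = 0 := hc.2
    change boundary F (push F φ c) = 0
    rw [boundary_push φ hc', h, map_zero]

theorem push_mem_boundaries [DecidableEq Y] {φ : X → Y} (hφ : ∀ σ ∈ K, σ.image φ ∈ L)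
    {c : Chain F X} (hc : c ∈ boundaries F K k) : push F φ c ∈ boundaries F L k := by
  obtain ⟨b, hb, rfl⟩ := hc
  exact ⟨push F φ b, push_mem_chains hφ hb, boundary_push φ hb⟩

variable (F) in
/-- The map on homology induced by a simplicial map. -/
def pushHomology [DecidableEq Y] {φ : X → Y} (hφ : ∀ σ ∈ K, σ.image φ ∈ L) (k : ℕ) :
    Homology F K k →ₗ[F] Homology F L k :=
  Submodule.mapQ _ _ ((push F φ).toLinearMap.restrict fun _ hc => push_mem_cycles hφ hc)
    (fun _ hc => push_mem_boundaries hφ hc)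

/-- Moving a single vertex `v` to `w` does not change homology classes if every face that
contains `v` stays a face when `w` is added to it. -/
theorem sub_push_update_mem_boundaries [DecidableEq X] {v w : X}
    (hK : ∀ σ ∈ K, v ∈ σ → insert w σ ∈ K) {c : Chain F X} (hc : c ∈ cycles F K k) :
    c - push F (Function.update id v w) c ∈ boundaries F K k := by
  set φ : X → X := Function.update id v w
  have hφ : ∀ x, x ≠ v → φ x = x := fun x hx => Function.update_of_ne hx _ _
  have hφv : φ v = w := Function.update_self _ _ _
  have hc' := cycles_le_chains _ _ hc
  -- The cone with apex `w` over `c - φ c`. Its boundary is `c - φ c` minus the cone over `∂c - φ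
  -- ∂c`, which vanishes. Simplices without `v` cancel in `c - φ c`, so only faces that may be
  -- enlarged by `w` contribute.
  refine ⟨ExteriorAlgebra.ι F (Finsupp.single w (1 : F)) * (c - push F φ c), ?_, ?_⟩
  · refine chains_induction (p := (chains F K (k + 1)).comap
      (LinearMap.mulLeft F (ExteriorAlgebra.ι F (Finsupp.single w (1 : F))) ∘ₗ
        (LinearMap.id - (push F φ).toLinearMap))) (fun x σ hσ hx => ?_) hc'
    change ExteriorAlgebra.ι F (Finsupp.single w (1 : F)) *
      (oriented F x - push F φ (oriented F x)) ∈ chains F K (k + 1)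
    rw [push_oriented]
    by_cases hv : v ∈ σ
    · have hsub : ∀ i, x i ∈ σ := fun i => by
        rw [← Finset.mem_coe, hx]
        exact ⟨i, rfl⟩
      have hw : w ∈ ((insert w σ : Finset X) : Set X) := by simp
      rw [mul_sub, ι_mul_oriented, ι_mul_oriented]
      refine Submodule.sub_mem _ (oriented_mem_chains (hK σ hσ hv) ?_)
        (oriented_mem_chains (hK σ hσ hv) ?_)
      · rw [Fin.range_cons]
        refine Set.insert_subset hw ?_
        rintro _ ⟨i, rfl⟩
        exact Finset.mem_insert_of_mem (hsub i)
      · rw [Fin.range_cons]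
        refine Set.insert_subset hw ?_
        rintro _ ⟨i, rfl⟩
        by_cases hi : x i = v
        · simp [hi, hφv]
        · rw [Function.comp_apply, hφ _ hi]
          exact Finset.mem_insert_of_mem (hsub i)
    · have hx' : φ ∘ x = x := funext fun i => hφ _ fun hi => hv <| by
        rw [← Finset.mem_coe, hx]
        exact ⟨i, hi⟩
      rw [hx', sub_self, mul_zero]
      exact Submodule.zero_mem _
  · rw [boundary_ι_mul, map_sub, boundary_push φ hc', push_boundary_of_mem_cycles φ hc, sub_self,
      mul_zero, sub_zero]

/-- The pullback of a filtration along a map of vertices. -/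
def Filtration.comap [DecidableEq X] (f : Filtration X) (π : Z → X) : Filtration Z where
  toFun σ := f (σ.image π)
  monotone' _ _ h := f.monotone (Finset.image_subset_image h)

theorem Filtration.mem_sublevel_comap_of_image_subset [DecidableEq X] (f : Filtration X)
    (π : Z → X) {t : ℝ} {σ τ : Finset Z} (hσ : σ ∈ (f.comap π).sublevel t) (hτ : τ.Nonempty)
    (h : τ.image π ⊆ σ.image π) : τ ∈ (f.comap π).sublevel t :=
  ⟨hτ, (f.monotone h).trans hσ.2⟩

/-- Membership of a nonempty set in the pulled-back complex depends only on its image under `π`, so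
`φ v` can be added to any face containing `v`. The vertices are therefore moved one at a time. -/
theorem sub_push_mem_boundaries_comap [DecidableEq X] [Finite Z] (f : Filtration X) (π : Z → X)
    {φ : Z → Z} (hπ : ∀ z, π (φ z) = π z) (hφ : ∀ z, φ (φ z) = φ z) {t : ℝ} {c : Chain F Z}
    (hc : c ∈ cycles F ((f.comap π).sublevel t) k) :
    c - push F φ c ∈ boundaries F ((f.comap π).sublevel t) k := by
  classical
  have := Fintype.ofFinite Z
  have hpart : ∀ (A : Finset Z), c - push F (fun z => if z ∈ A then φ z else z) c ∈
      boundaries F ((f.comap π).sublevel t) k := by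
    intro A
    induction A using Finset.induction_on with
    | empty =>
      have h : (fun z : Z => if z ∈ (∅ : Finset Z) then φ z else z) = id := by ext; simp
      rw [h, push_id, sub_self]
      exact Submodule.zero_mem _
    | insert v A hv ih =>
      set ψ : Z → Z := fun z => if z ∈ A then φ z else z
      have hψπ : ∀ z, π (ψ z) = π z := fun z => by
        by_cases hz : z ∈ A <;> simp [ψ, hz, hπ]
      -- Idempotence is needed here: a vertex already moved onto `v` must not move again, and indeed
      -- `φ z = v` forces `φ v = v`.
      have h1 : (fun z => if z ∈ insert v A then φ z else z) =
          Function.update id v (φ v) ∘ ψ := by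
        funext z
        by_cases hz : z ∈ A
        · rw [if_pos (Finset.mem_insert_of_mem hz)]
          by_cases hzv : φ z = v
          · simp [ψ, hz, ← hzv, hφ]
          · simp [ψ, hz, hzv]
        · by_cases hzv : z = v
          · subst hzv
            simp [ψ, hz]
          · simp [ψ, hz, hzv]
      have h2 : push F ψ c ∈ cycles F ((f.comap π).sublevel t) k := by
        refine push_mem_cycles (fun σ hσ => ?_) hc
        refine f.mem_sublevel_comap_of_image_subset π hσ (hσ.1.image ψ) ?_
        rw [Finset.image_image]
        exact (Finset.image_congr fun z _ => hψπ z).subset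
      have h3 := sub_push_update_mem_boundaries (v := v) (w := φ v) (fun σ hσ hvσ =>
        f.mem_sublevel_comap_of_image_subset π hσ (Finset.insert_nonempty _ _) (by
          rw [Finset.image_insert, hπ]
          exact Finset.insert_subset (Finset.mem_image_of_mem π hvσ) subset_rfl)) h2
      rw [h1, ← push_push]
      simpa using Submodule.add_mem _ ih h3
  simpa using hpart Finset.univ

variable (F) in
-- A section `s` of `π` gives the inverse: `π ∘ s` is the identity, while `s ∘ π` is idempotent and
-- preserves the fibres of `π`, so it acts trivially on homology.
theorem isIsomorphic_comap [DecidableEq X] [Finite Z] (f : Filtration X) {π : Z → X}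
    (hπ : Function.Surjective π) (k : ℕ) :
    ((f.comap π).persistentHomology F k).IsIsomorphic (f.persistentHomology F k) := by
  classical
  obtain ⟨s, hs⟩ := hπ.hasRightInverse
  have h1 : ∀ t, ∀ σ ∈ (f.comap π).sublevel t, σ.image π ∈ f.sublevel t :=
    fun t σ hσ => ⟨hσ.1.image π, hσ.2⟩
  have h2 : ∀ t, ∀ σ ∈ f.sublevel t, σ.image s ∈ (f.comap π).sublevel t := by
    refine fun t σ hσ => ⟨hσ.1.image s, ?_⟩
    change f ((σ.image s).image π) ≤ t
    rw [Finset.image_image, hs.comp_eq_id, Finset.image_id]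
    exact hσ.2
  refine ⟨fun t => LinearEquiv.ofLinearMap (pushHomology F (h1 t) k) (pushHomology F (h2 t) k)
    (LinearMap.ext fun x => ?_) (LinearMap.ext fun x => ?_), fun t t' h x => ?_⟩
  · obtain ⟨⟨c, hc⟩, rfl⟩ := Submodule.Quotient.mk_surjective _ x
    refine congrArg Submodule.Quotient.mk (Subtype.ext ?_)
    change push F π (push F s c) = c
    rw [push_push, hs.comp_eq_id, push_id]
  · obtain ⟨⟨c, hc⟩, rfl⟩ := Submodule.Quotient.mk_surjective _ x
    refine Eq.symm ((Submodule.Quotient.eq _).2 ?_)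
    change c - push F s (push F π c) ∈ boundaries F ((f.comap π).sublevel t) k
    rw [push_push]
    exact sub_push_mem_boundaries_comap f π (fun z => hs (π z))
      (fun z => congrArg s (hs (π z))) hc
  · obtain ⟨c, rfl⟩ := Submodule.Quotient.mk_surjective _ x
    rfl

end Pullback

/-! ### The Rips filtration -/

section Rips

theorem rips_image_le {X : Type v} {Y : Type w} [MetricSpace X] [MetricSpace Y] [DecidableEq X]
    [DecidableEq Y] {Z : Type*} (p : Z → X) (q : Z → Y) {ε : ℝ} (hε : 0 ≤ ε)
    (h : ∀ z z', |dist (p z) (p z') - dist (q z) (q z')| ≤ ε) (σ : Finset Z) :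
    rips X (σ.image p) ≤ rips Y (σ.image q) + ε := by
  refine Metric.diam_le_of_forall_dist_le (add_nonneg Metric.diam_nonneg hε) ?_
  simp only [Finset.coe_image]
  rintro _ ⟨z, hz, rfl⟩ _ ⟨z', hz', rfl⟩
  have h1 : dist (q z) (q z') ≤ Metric.diam (q '' σ) :=
    Metric.dist_le_diam_of_mem (σ.finite_toSet.image q).isBounded ⟨z, hz, rfl⟩ ⟨z', hz', rfl⟩
  have h2 : rips Y (σ.image q) = Metric.diam (q '' σ) := by
    change Metric.diam ((σ.image q : Finset Y) : Set Y) = _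
    rw [Finset.coe_image]
  linarith [(abs_le.1 (h z z')).2]

theorem bottleneckDist_rips_le_distortion (F : Type u) [Field F] {X : Type v} {Y : Type w}
    [MetricSpace X] [Finite X] [MetricSpace Y] [Finite Y] {R : Set (X × Y)}
    (hR : IsCorrespondence R) (k : ℕ) :
    bottleneckDist (diagram ((rips X).persistentHomology F k))
      (diagram ((rips Y).persistentHomology F k)) ≤ distortion R := by
  classical
  rcases eq_or_ne (distortion R) ⊤ with htop | htop
  · exact htop ▸ le_top
  have hdist : ∀ z z' : R, |dist z.1.1 z'.1.1 - dist z.1.2 z'.1.2| ≤ (distortion R).toReal := by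
    refine fun z z' => (ENNReal.ofReal_le_iff_le_toReal htop).1 ?_
    exact le_iSup₂_of_le z.1 z.2 (le_iSup₂_of_le (f := fun q (_ : q ∈ R) =>
      ENNReal.ofReal |dist z.1.1 q.1 - dist z.1.2 q.2|) z'.1 z'.2 le_rfl)
  have hX : Function.Surjective fun z : R => z.1.1 := fun x =>
    (hR.1 x).elim fun y h => ⟨⟨(x, y), h⟩, rfl⟩
  have hY : Function.Surjective fun z : R => z.1.2 := fun y =>
    (hR.2 y).elim fun x h => ⟨⟨(x, y), h⟩, rfl⟩
  -- Both Rips filtrations are compared on the common vertex set `R`.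
  have h := diagramsWithin_of_abs_sub_le F ((rips X).comap fun z : R => z.1.1)
    ((rips Y).comap fun z : R => z.1.2) ENNReal.toReal_nonneg (fun σ => abs_sub_le_iff.2
      ⟨sub_le_iff_le_add'.2 (rips_image_le _ _ ENNReal.toReal_nonneg hdist σ),
        sub_le_iff_le_add'.2 (rips_image_le _ _ ENNReal.toReal_nonneg (fun z z' => by
          rw [abs_sub_comm]; exact hdist z z') σ)⟩) k
  rw [((isIsomorphic_comap F (rips X) hX k).isDiagram (isDiagram_diagram F (rips X) k)).diagram_eq,
    ((isIsomorphic_comap F (rips Y) hY k).isDiagram (isDiagram_diagram F (rips Y) k)).diagram_eq,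
    ENNReal.ofReal_toReal htop] at h
  exact h.elim fun _ hm => bottleneckDist_le hm

end Rips

end PersistentHomology

theorem theorem5p1 (F : Type*) [Field F] (X Y : Type*) [MetricSpace X] [Finite X]
    [MetricSpace Y] [Finite Y] (k : ℕ) :
    (∃! D, PersistentHomology.IsDiagram
      ((PersistentHomology.rips X).persistentHomology F k) D) ∧
    (∃! D, PersistentHomology.IsDiagram
      ((PersistentHomology.rips Y).persistentHomology F k) D) ∧
    PersistentHomology.bottleneckDist
        (PersistentHomology.diagram ((PersistentHomology.rips X).persistentHomology F k))
        (PersistentHomology.diagram ((PersistentHomology.rips Y).persistentHomology F k)) ≤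
      2 * PersistentHomology.ghDist X Y := by
  refine ⟨⟨_, PersistentHomology.isDiagram_diagram F _ k, fun _ h => h.diagram_eq.symm⟩,
    ⟨_, PersistentHomology.isDiagram_diagram F _ k, fun _ h => h.diagram_eq.symm⟩, ?_⟩
  rw [PersistentHomology.ghDist, ENNReal.mul_div_cancel two_ne_zero ENNReal.ofNat_ne_top]
  exact le_iInf₂ fun _ hR => PersistentHomology.bottleneckDist_rips_le_distortion F hR k
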